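/- For odd $N$ and real parameters $M_1, M_2, \beta$, let $\pi = \pi_{N,M_1,M_2,\beta}$ be the distribution of $n = 2N$ variables $X_1,\dots,X_N,Y_1,\dots,Y_N \in \{-1,1\}$ given by $\pi(X,Y) = \frac1Z \exp\left(\phi_X(X)+\phi_Y(X,Y)\right)$, where $\phi_X(X) = -M_1 |\mathbf 1^T X|$, and $\phi_Y(X,Y) = \frac{\beta}{N}(\mathbf 1^T Y)^2$ if $|\mathbf 1^T X| = 1$, $\phi_Y(X,Y) = M_2 (\mathbf 1^T Y)^2$ if $|\mathbf 1^T X| > 1$. Sequential Gibbs sampling on $\pi$ repeatedly chooses one of the $n$ variables uniformly at random and resamples it from its conditional law under $\pi$ given the current values of all other variables. In Hogwild!-Gibbs sampling, at each time $t$, given the whole past $\mathcal F_t$, a vector of delays $\tilde\tau_{i,t} \in \{0,\dots,t\}$ ($1\le i\le n$) is drawn from some law and, independently of it, a uniform index $\tilde I_t$; the variable $\tilde I_t$ is then resampled from its conditional law under $\pi$ given the stale values $x_{i,t-\tilde\tau_{i,t}}$ of the other variables, and the others keep their values. The delay model has parameters $\tau,\tau^*$ if $\mathbf E[\tilde\tau_{i,t}\mid\mathcal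 F_t]\le\tau$ and $\mathbf E[\exp(n^{-1}\tilde\tau_{i,t})\mid\mathcal F_t]\le 1+n^{-1}\tau^*$ for all $i$ and $t$. If $P^{(t)}\mu_0$ is the law of the state at time $t$ of a process started from $\mu_0$, its mixing time is $t_{\mathrm{mix}}(\epsilon) = \min\{t : \|P^{(t)}\mu_0 - P^{(t)}\pi\|_{\mathrm{TV}} \le \epsilon \text{ for all } \mu_0\}$, where $\|\mu-\nu\|_{\mathrm{TV}} = \max_A |\mu(A)-\nu(A)|$ (and $t_{\mathrm{mix}}(\epsilon)=\infty$ if there is no such $t$). Then there are positive parameters $M_1, M_2, \beta$, as functions of $N$, such that the following two statements hold. 1. For every $\epsilon > 0$, the mixing time of sequential Gibbs sampling on $\pi$ satisfies $t_{\mathrm{mix}}(\epsilon) = O(N\log N)$ as $N \to \infty$ through the odd integers. 2. For the same parameters, there are constants $\tau,\tau^*$ independent of $N$ and, for every $N$, a delay model with parameters $\tau,\tau^*$ (in which the law of the delays at time $t$ depends on $t$ only, not on the past of the sampler), such that the mixing time of the resulting Hogwild!-Gibbs sampler on $\pi$ is $\exp(\Omega(N))$: there is $c>0$ such that for every $\epsilon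 \in (0,1/2)$, $t_{\mathrm{mix}}(\epsilon) \ge \exp(cN)$ for all sufficiently large odd $N$. -/

import Mathlib

open scoped NNReal ENNReal

noncomputable section

namespace GibbsMixing

/-! ### Total variation distance and mixing time -/

/-- Total variation distance: the largest difference of the probabilities given to one event. -/
def tvDist {Ω : Type*} (μ ν : PMF Ω) : ℝ :=
  ⨆ A : Set Ω, |(μ.toOuterMeasure A).toReal - (ν.toOuterMeasure A).toReal|

/-- Mixing time of a process whose time-`t` law is `P t μ₀` when it is started from `μ₀`, with
target distribution `π`: the first `t` at which `P t μ₀` is `ε`-close to `P t π` for every `μ₀`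
(and `⊤` if there is no such `t`). -/
def mixingTime {Ω : Type*} (P : ℕ → PMF Ω → PMF Ω) (π : PMF Ω) (ε : ℝ) : ℕ∞ :=
  ⨅ t ∈ {t : ℕ | ∀ μ₀ : PMF Ω, tvDist (P t μ₀) (P t π) ≤ ε}, (t : ℕ∞)

/-! ### Sequential Gibbs sampling

`V` is the finite set of variables and `S` the finite set of values. -/

section Samplers

variable {V S : Type*} [Fintype V] [DecidableEq V] [Fintype S] [Nonempty S]

/-- The conditional law under `π` of variable `i` given the values `v` of all other variables:
`z` has probability proportional to `π (v with v i replaced by z)`. -/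
def conditional (π : PMF (V → S)) (hπ : ∀ x, π x ≠ 0) (i : V) (v : V → S) : PMF S :=
  PMF.normalize (fun z => π (Function.update v i z))
    (fun h => hπ _ (ENNReal.tsum_eq_zero.mp h (Classical.arbitrary S)))
    (by
      rw [tsum_fintype]
      exact ENNReal.sum_ne_top.mpr fun z _ => π.apply_ne_top _)

/-- One step of sequential Gibbs sampling: resample a uniformly chosen variable. -/
def seqStep [Nonempty V] (π : PMF (V → S)) (hπ : ∀ x, π x ≠ 0) (x : V → S) : PMF (V → S) :=
  (PMF.uniformOfFintype V).bind fun i =>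
    (conditional π hπ i x).map fun z => Function.update x i z

/-- The law after `t` steps of sequential Gibbs sampling started from `μ₀`. -/
def seqLaw [Nonempty V] (π : PMF (V → S)) (hπ : ∀ x, π x ≠ 0) (t : ℕ) (μ₀ : PMF (V → S)) :
    PMF (V → S) :=
  (fun μ => μ.bind (seqStep π hπ))^[t] μ₀

end Samplers

/-! ### Hogwild Gibbs sampling -/

/-- What happens in one write: the delays, the index of the resampled variable, and the state
of the system after the write. -/
structure Write (V S : Type*) where
  delay : V → ℕ
  index : V
  state : V → S

/-- Everything that has happened up to some time: the initial state, and the list of all writes so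
far, the most recent one first. -/
structure History (V S : Type*) where
  init : V → S
  writes : List (Write V S)

namespace History

variable {V S : Type*}

/-- The number `t` of writes that have occurred. -/
def time (h : History V S) : ℕ := h.writes.length

/-- The state `x_t` of the system at the current time. -/
def current (h : History V S) : V → S :=
  match h.writes with
  | [] => h.init
  | w :: _ => w.state

/-- The history up to `k` writes ago (up to time `t - k`). -/
def back (h : History V S) (k : ℕ) : History V S := ⟨h.init, h.writes.drop k⟩

/-- The cached values `v_{i,t} = x_{i, t - d i}`. -/
def stale (h : History V S) (d : V → ℕ) : V → S := fun i => (h.back (d i)).current i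

/-- Append the write of value `z` to variable `i`, made with delays `d`. -/
def push [DecidableEq V] (h : History V S) (d : V → ℕ) (i : V) (z : S) : History V S :=
  ⟨h.init, ⟨d, i, Function.update h.current i z⟩ :: h.writes⟩

end History

/-- A model of the hardware: the conditional law, given everything that has happened up to time
`t`, of the vector of delays used at time `t`. No delay reaches back before time `0`. -/
structure DelayModel (V S : Type*) where
  law : History V S → PMF (V → ℕ)
  le_time : ∀ h, ∀ d ∈ (law h).support, ∀ i, d i ≤ h.time

namespace DelayModel

variable {V S : Type*}

/-- The conditional expected delay `E[τ_{i,t} | F_t]` is at most `τ`. -/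
def ExpectedDelayLE (D : DelayModel V S) (τ : ℝ≥0) : Prop :=
  ∀ h i, ∑' d, D.law h d * (d i : ℝ≥0∞) ≤ τ

/-- The tail bound `E[exp (τ_{i,t} / n) | F_t] ≤ 1 + τ' / n`, with `n` the number of variables. -/
def ExpDelayLE [Fintype V] (D : DelayModel V S) (τ' : ℝ≥0) : Prop :=
  ∀ h i, ∑' d, D.law h d * ENNReal.ofReal (Real.exp ((d i : ℝ) / Fintype.card V)) ≤
    1 + (τ' : ℝ≥0∞) / (Fintype.card V : ℝ≥0∞)

/-- The law of the delays depends on the time only, not on the course of the sampler. -/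
def Oblivious (D : DelayModel V S) : Prop :=
  ∀ h h' : History V S, h.time = h'.time → D.law h = D.law h'

end DelayModel

section Hogwild

variable {V S : Type*} [Fintype V] [DecidableEq V] [Nonempty V] [Fintype S] [Nonempty S]

/-- One write of Hogwild Gibbs: the delays are drawn from the delay model, independently of them a
uniform variable is chosen, and it is resampled using the cached values of the others. -/
def hogStep (π : PMF (V → S)) (hπ : ∀ x, π x ≠ 0) (D : DelayModel V S) (h : History V S) :
    PMF (History V S) :=
  (D.law h).bind fun d =>
    (PMF.uniformOfFintype V).bind fun i =>
      (conditional π hπ i (h.stale d)).map fun z => h.push d i z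

/-- The law of the state after `t` writes of Hogwild Gibbs started from `μ₀`. -/
def hogLaw (π : PMF (V → S)) (hπ : ∀ x, π x ≠ 0) (D : DelayModel V S) (t : ℕ)
    (μ₀ : PMF (V → S)) : PMF (V → S) :=
  ((fun μ => μ.bind (hogStep π hπ D))^[t] (μ₀.map fun x => ⟨x, []⟩)).map History.current

end Hogwild

/-! ### The two-bank model -/

/-- The `2 N` variables: `Sum.inl i` is `X_i` and `Sum.inr i` is `Y_i`. -/
abbrev Var (N : ℕ) : Type := Fin N ⊕ Fin N

/-- States: every variable has a value in `ℤˣ = {1, -1}`. -/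
abbrev State (N : ℕ) : Type := Var N → ℤˣ

/-- `1ᵀX`. -/
def sumX {N : ℕ} (σ : State N) : ℤ := ∑ i, (σ (Sum.inl i) : ℤ)

/-- `1ᵀY`. -/
def sumY {N : ℕ} (σ : State N) : ℤ := ∑ i, (σ (Sum.inr i) : ℤ)

/-- `φ_X(X) = -M₁ |1ᵀX|`. -/
def energyX {N : ℕ} (M₁ : ℝ) (σ : State N) : ℝ := -M₁ * |(sumX σ : ℝ)|

/-- `φ_Y(X, Y)`, which is `(β / N) (1ᵀY)²` if `|1ᵀX| = 1`, and `M₂ (1ᵀY)²` otherwise (for odd `N`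
this means `|1ᵀX| > 1`). -/
def energyY {N : ℕ} (M₂ β : ℝ) (σ : State N) : ℝ :=
  if |sumX σ| = 1 then β / N * (sumY σ : ℝ) ^ 2 else M₂ * (sumY σ : ℝ) ^ 2

/-- The distribution `π(X, Y) = exp (φ_X(X) + φ_Y(X, Y)) / Z`. -/
def twoBank (N : ℕ) (M₁ M₂ β : ℝ) : PMF (State N) :=
  PMF.normalize (fun σ => ENNReal.ofReal (Real.exp (energyX M₁ σ + energyY M₂ β σ)))
    (fun h => (ENNReal.ofReal_pos.mpr (Real.exp_pos _)).ne'
      (ENNReal.tsum_eq_zero.mp h (fun _ => 1)))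
    (by
      rw [tsum_fintype]
      exact ENNReal.sum_ne_top.mpr fun _ _ => ENNReal.ofReal_ne_top)

theorem twoBank_ne_zero (N : ℕ) (M₁ M₂ β : ℝ) (σ : State N) : twoBank N M₁ M₂ β σ ≠ 0 := by
  rw [← PMF.mem_support_iff, twoBank, PMF.mem_support_normalize_iff]
  exact (ENNReal.ofReal_pos.mpr (Real.exp_pos _)).ne'

/-- The mixing time of sequential Gibbs sampling on the two-bank model. -/
def seqMixingTime (N : ℕ) [NeZero N] (M₁ M₂ β ε : ℝ) : ℕ∞ :=
  mixingTime (seqLaw (twoBank N M₁ M₂ β) (twoBank_ne_zero N M₁ M₂ β)) (twoBank N M₁ M₂ β) ε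

/-- The mixing time of Hogwild Gibbs sampling on the two-bank model, with delay model `D`. -/
def hogMixingTime (N : ℕ) [NeZero N] (M₁ M₂ β : ℝ) (D : DelayModel (Var N) ℤˣ) (ε : ℝ) : ℕ∞ :=
  mixingTime (hogLaw (twoBank N M₁ M₂ β) (twoBank_ne_zero N M₁ M₂ β) D) (twoBank N M₁ M₂ β) ε

end GibbsMixing

end

/-! The magnetization of the first bank is odd. While it is `±1`, the second bank is a weakly
coupled mean-field model; otherwise it is strongly ferromagnetic. Correct reads almost never produce
the second case, but inconsistent stale reads produce it at a constant rate. The parameters are `M₁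
= N ^ 2 + 1`, `M₂ = 1`, `β = 1 / 32`.

Sequential sampling. The second bank can gain at most `M₂ N²` from an unbalanced first bank, which
`M₁` outweighs: a spin of the first bank is aligned with a nonzero sum of the others with
probability at most `exp (-N² - 2)` (`cond_inl_le`). Up to this error per step
(`abs_seqOp_sub_idealOp_le`) the sampler is one that never does so. For that ideal sampler a
coupling contracts the distance `pot`, which is at most `34 N`, by the factor `1 - 1 / (34 N)`
(`idealOp_sub_le`). Outside the two middle layers the magnetization falls; from opposite middle
layers the magnetizations meet at a constant rate; on a common middle layer a suitable matching of
the indices shrinks the Hamming distance of the first banks, and weak coupling shrinks that of the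
second. Couplings appear dually, as bounds on `f x - f y` for test functions `f`. Hence `O(N log N)`
steps suffice.

Hogwild sampling. At every third write each variable of the first bank is read, by a fair coin,
either now or as it was two writes ago. If these two writes flipped `X_i` from `e` to `-e` and `X_j`
from `-e` to `e`, where `e` is the magnetization, the view may contain the old `X_i` and the new
`X_j`; its magnetization is `3 e` although every true state was balanced. This has probability at
least `1 / 384` from each balanced state, and unbalanced states are no worse (`le_expect_viewProb`).
A second-bank write with such a view is pulled towards the current majority with constant strength,
whereas the pull of the other writes towards one half is only of order `θ` when the minority
fraction is within `θ / 2` of one half. So `exp (θ · minority)` does not grow on average over a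
block of three writes in that window (`expect_blockStep_expPot_le`), and crossing the window takes
time exponential in `N` (`expect_hogFrom_minority_le`). Until then the starts from all `1` and all
`-1` keep opposite majorities, and no single law is close to both. -/

namespace GibbsMixing

/-! ### Expectations over finite types -/

section Expect

variable {α γ : Type*} [Fintype α] [Fintype γ]

/-- The expectation of a real function under a law on a finite type. -/
noncomputable def expect (p : PMF α) (f : α → ℝ) : ℝ := ∑ a, (p a).toReal * f a

theorem sum_toReal_eq_one (p : PMF α) : ∑ a, (p a).toReal = 1 := by
  rw [← ENNReal.toReal_sum fun a _ => p.apply_ne_top a, ← tsum_fintype (L := .unconditional _),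
    p.tsum_coe]
  rfl

theorem expect_bind (p : PMF α) (k : α → PMF γ) (f : γ → ℝ) :
    expect (p.bind k) f = expect p fun a => expect (k a) f := by
  simp only [expect, PMF.bind_apply, tsum_fintype, Finset.mul_sum]
  rw [Finset.sum_comm]
  refine Finset.sum_congr rfl fun c _ => ?_
  rw [ENNReal.toReal_sum fun a _ => ENNReal.mul_ne_top (p.apply_ne_top a) ((k a).apply_ne_top c),
    Finset.sum_mul]
  simp only [ENNReal.toReal_mul, mul_assoc]

theorem expect_pure (a : α) (f : α → ℝ) : expect (PMF.pure a) f = f a := by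
  classical
  rw [expect, Finset.sum_eq_single a] <;> simp +contextual [PMF.pure_apply]

theorem expect_map (p : PMF α) (g : α → γ) (f : γ → ℝ) :
    expect (p.map g) f = expect p fun a => f (g a) := by
  rw [← PMF.bind_pure_comp, expect_bind]
  simp only [Function.comp, expect_pure]

theorem expect_const (p : PMF α) (c : ℝ) : expect p (fun _ => c) = c := by
  rw [expect, ← Finset.sum_mul, sum_toReal_eq_one, one_mul]

theorem expect_mono (p : PMF α) {f g : α → ℝ} (h : ∀ a, f a ≤ g a) : expect p f ≤ expect p g :=
  Finset.sum_le_sum fun a _ => mul_le_mul_of_nonneg_left (h a) ENNReal.toReal_nonneg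

theorem expect_le (p : PMF α) {f : α → ℝ} {c : ℝ} (h : ∀ a, f a ≤ c) : expect p f ≤ c :=
  (expect_mono p h).trans_eq (expect_const p c)

theorem le_expect (p : PMF α) {f : α → ℝ} {c : ℝ} (h : ∀ a, c ≤ f a) : c ≤ expect p f :=
  (expect_const p c).symm.trans_le (expect_mono p h)

theorem expect_sub (p : PMF α) (f g : α → ℝ) :
    expect p (fun a => f a - g a) = expect p f - expect p g := by
  simp only [expect, mul_sub, Finset.sum_sub_distrib]

theorem expect_add (p : PMF α) (f g : α → ℝ) :
    expect p (fun a => f a + g a) = expect p f + expect p g := by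
  simp only [expect, mul_add, Finset.sum_add_distrib]

theorem expect_const_mul (p : PMF α) (c : ℝ) (f : α → ℝ) :
    expect p (fun a => c * f a) = c * expect p f := by
  simp only [expect, Finset.mul_sum, mul_left_comm]

theorem expect_uniform [Nonempty α] (f : α → ℝ) :
    expect (PMF.uniformOfFintype α) f = (∑ a, f a) / Fintype.card α := by
  simp only [expect, PMF.uniformOfFintype_apply, ENNReal.toReal_inv, ENNReal.toReal_natCast,
    ← Finset.mul_sum]
  rw [div_eq_inv_mul]

theorem expect_sub_expect_le (p q : PMF α) {f : α → ℝ} {c : ℝ} (h : ∀ a b, f a - f b ≤ c) :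
    expect p f - expect q f ≤ c := by
  have h₁ : expect p f ≤ expect q f + c := by
    refine expect_le p fun a => ?_
    rw [← expect_const q c, ← expect_add]
    exact le_expect q fun b => by linarith [h a b]
  linarith

theorem toReal_toOuterMeasure (p : PMF α) (A : Set α) :
    (p.toOuterMeasure A).toReal = expect p (A.indicator 1) := by
  classical
  rw [PMF.toOuterMeasure_apply, tsum_fintype, ENNReal.toReal_sum, expect]
  · refine Finset.sum_congr rfl fun a _ => ?_
    by_cases h : a ∈ A <;> simp [h]
  · intro a _
    by_cases h : a ∈ A <;> simp [h, p.apply_ne_top]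

theorem sum_units (f : ℤˣ → ℝ) (e : ℤˣ) : ∑ z, f z = f e + f (-e) := by
  have h : ∀ e x : ℤˣ, ¬(x ≠ e ∧ x ≠ -e) := by decide
  exact Fintype.sum_eq_add e (-e) (by revert e; decide) fun x hx => absurd hx (h e x)

/-- Expectations of two functions that are close where the values agree, and not much further apart
where they differ, under two laws on `ℤˣ`. -/
theorem expect_units_sub_le (p q : PMF ℤˣ) {F G : ℤˣ → ℝ} {b k : ℝ} (h₀ : ∀ z, F z - G z ≤ b)
    (h₁ : ∀ z w, F z - G w ≤ b + k) :
    expect p F - expect q G ≤ b + k * |(p 1).toReal - (q 1).toReal| := by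
  have hp := sum_toReal_eq_one p
  have hq := sum_toReal_eq_one q
  rw [sum_units _ 1] at hp hq
  rw [expect, expect, sum_units _ 1, sum_units _ 1]
  set p₁ := (p 1).toReal
  set q₁ := (q 1).toReal
  have hp₁ : 0 ≤ p₁ := ENNReal.toReal_nonneg
  have hq₁ : 0 ≤ q₁ := ENNReal.toReal_nonneg
  have hp₂ : 0 ≤ (p (-1)).toReal := ENNReal.toReal_nonneg
  have hq₂ : 0 ≤ (q (-1)).toReal := ENNReal.toReal_nonneg
  have ep : (p (-1)).toReal = 1 - p₁ := by linarith
  have eq : (q (-1)).toReal = 1 - q₁ := by linarith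
  rw [ep] at hp₂
  rw [eq] at hq₂
  rw [ep, eq]
  have a₁ := h₀ 1
  have a₂ := h₀ (-1)
  have a₃ := h₁ 1 (-1)
  have a₄ := h₁ (-1) 1
  -- The maximal coupling of the two laws, written out: the common mass at each value is paired with
  -- itself, and the remaining mass `|p₁ - q₁|` is paired with the opposite value.
  rcases le_total p₁ q₁ with h | h
  · rw [abs_of_nonpos (by linarith)]
    have b₁ := mul_le_mul_of_nonneg_left a₁ hp₁
    have b₂ := mul_le_mul_of_nonneg_left a₂ hq₂
    have b₃ := mul_le_mul_of_nonneg_left a₄ (sub_nonneg.mpr h)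
    linarith
  · rw [abs_of_nonneg (by linarith)]
    have b₁ := mul_le_mul_of_nonneg_left a₁ hq₁
    have b₂ := mul_le_mul_of_nonneg_left a₂ hp₂
    have b₃ := mul_le_mul_of_nonneg_left a₃ (sub_nonneg.mpr h)
    linarith

end Expect

/-! ### Total variation distance and mixing time -/

theorem toReal_toOuterMeasure_le_one {Ω : Type*} (μ : PMF Ω) (A : Set Ω) :
    (μ.toOuterMeasure A).toReal ≤ 1 :=
  ENNReal.toReal_le_of_le_ofReal zero_le_one <| by
    rw [ENNReal.ofReal_one]
    exact (μ.toOuterMeasure.mono (Set.subset_univ A)).trans_eq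
      ((PMF.toOuterMeasure_apply_eq_one_iff μ _).2 (Set.subset_univ _))

theorem abs_sub_le_tvDist {Ω : Type*} (μ ν : PMF Ω) (A : Set Ω) :
    |(μ.toOuterMeasure A).toReal - (ν.toOuterMeasure A).toReal| ≤ tvDist μ ν := by
  refine le_ciSup (f := fun A : Set Ω =>
    |(μ.toOuterMeasure A).toReal - (ν.toOuterMeasure A).toReal|) ⟨1, ?_⟩ A
  rintro _ ⟨B, rfl⟩
  have h₁ := toReal_toOuterMeasure_le_one μ B
  have h₂ := toReal_toOuterMeasure_le_one ν B
  have h₃ : 0 ≤ (μ.toOuterMeasure B).toReal := ENNReal.toReal_nonneg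
  have h₄ : 0 ≤ (ν.toOuterMeasure B).toReal := ENNReal.toReal_nonneg
  exact abs_le.2 ⟨by linarith, by linarith⟩

theorem mixingTime_le {Ω : Type*} {P : ℕ → PMF Ω → PMF Ω} {π : PMF Ω} {ε : ℝ} {t : ℕ}
    (h : ∀ μ₀, tvDist (P t μ₀) (P t π) ≤ ε) : mixingTime P π ε ≤ t :=
  iInf₂_le t h

theorem ofReal_le_mixingTime {Ω : Type*} {P : ℕ → PMF Ω → PMF Ω} {π : PMF Ω} {ε r : ℝ}
    (h : ∀ t : ℕ, (t : ℝ) < r → ∃ μ₀, ε < tvDist (P t μ₀) (P t π)) :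
    ENNReal.ofReal r ≤ (mixingTime P π ε : ℝ≥0∞) := by
  have key : ((⌈r⌉₊ : ℕ) : ℕ∞) ≤ mixingTime P π ε := by
    refine le_iInf₂ fun t ht => ?_
    rw [Nat.cast_le, Nat.ceil_le]
    by_contra! hlt
    obtain ⟨μ₀, hμ₀⟩ := h t hlt
    exact absurd (ht μ₀) hμ₀.not_ge
  calc ENNReal.ofReal r ≤ ENNReal.ofReal (⌈r⌉₊ : ℕ) := ENNReal.ofReal_le_ofReal (Nat.le_ceil r)
    _ = (((⌈r⌉₊ : ℕ) : ℕ∞) : ℝ≥0∞) := by simp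
    _ ≤ _ := ENat.toENNReal_le.2 key

/-! ### One write made with an arbitrary view of the state -/

section StaleStep

variable {V S : Type*} [Fintype V] [DecidableEq V] [Nonempty V] [Fintype S] [Nonempty S]

/-- Resample in the state `x` a uniformly chosen variable, using the view `v` of the others. -/
noncomputable def staleStep (π : PMF (V → S)) (hπ : ∀ x, π x ≠ 0) (v x : V → S) : PMF (V → S) :=
  (PMF.uniformOfFintype V).bind fun i =>
    (conditional π hπ i v).map fun z => Function.update x i z

theorem expect_staleStep (π : PMF (V → S)) (hπ : ∀ x, π x ≠ 0) (v x : V → S)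
    (f : (V → S) → ℝ) :
    expect (staleStep π hπ v x) f =
      (∑ i, expect (conditional π hπ i v) fun z => f (Function.update x i z)) /
        Fintype.card V := by
  simp only [staleStep, expect_bind, expect_map, expect_uniform]

/-- Duality: instead of pushing laws forward, the step operator is iterated on the test function.
Mixing then amounts to a decay of oscillation. -/
theorem expect_seqLaw (π : PMF (V → S)) (hπ : ∀ x, π x ≠ 0) (t : ℕ) (μ : PMF (V → S))
    (f : (V → S) → ℝ) :
    expect (seqLaw π hπ t μ) f =
      expect μ ((fun g x => expect (staleStep π hπ x x) g)^[t] f) := by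
  induction t generalizing f with
  | zero => rfl
  | succ t ih =>
    rw [seqLaw, Function.iterate_succ_apply', expect_bind, Function.iterate_succ_apply, ← ih]
    rfl

end StaleStep

/-! ### Conditional laws of the two-bank model -/

theorem expect_units (p : PMF ℤˣ) (f : ℤˣ → ℝ) (e : ℤˣ) :
    expect p f = (p e).toReal * f e + (p (-e)).toReal * f (-e) :=
  sum_units _ e

theorem toReal_units_add (p : PMF ℤˣ) (e : ℤˣ) : (p e).toReal + (p (-e)).toReal = 1 := by
  rw [← sum_units (fun z => (p z).toReal) e, sum_toReal_eq_one]

section TwoBank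

variable {N : ℕ} (M₁ M₂ β : ℝ)

/-- The conditional law of variable `i` in the two-bank model. -/
noncomputable abbrev cond (i : Var N) (v : State N) : PMF ℤˣ :=
  conditional (twoBank N M₁ M₂ β) (twoBank_ne_zero N M₁ M₂ β) i v

/-- Only the ratio of the weights of the two values matters, so the partition function cancels. -/
theorem cond_apply (i : Var N) (v : State N) (z : ℤˣ) {a b : ℝ}
    (ha : energyX M₁ (Function.update v i z) + energyY M₂ β (Function.update v i z) = a)
    (hb : energyX M₁ (Function.update v i (-z)) + energyY M₂ β (Function.update v i (-z)) = b) :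
    (cond M₁ M₂ β i v z).toReal = 1 / (1 + Real.exp (b - a)) := by
  have hodds : (cond M₁ M₂ β i v z).toReal * Real.exp b =
      (cond M₁ M₂ β i v (-z)).toReal * Real.exp a := by
    simp only [cond, conditional, twoBank, PMF.normalize_apply, ENNReal.toReal_mul, ha, hb,
      ENNReal.toReal_ofReal (Real.exp_pos _).le]
    ring
  have hadd := toReal_units_add (cond M₁ M₂ β i v) z
  have ha' := Real.exp_pos a
  have hb' := Real.exp_pos b
  rw [Real.exp_sub, eq_div_iff (by positivity)]
  field_simp
  linear_combination hodds + Real.exp a * hadd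

end TwoBank

/-! ### Sums of spins -/

section Magnetization

variable {N : ℕ}

/-- The sum of the spins of one bank. -/
def magn (X : Fin N → ℤˣ) : ℤ := ∑ i, (X i : ℤ)

theorem magn_update (X : Fin N → ℤˣ) (i : Fin N) (z : ℤˣ) :
    magn (Function.update X i z) = magn X - X i + z := by
  have h : (fun j => ((Function.update X i z j : ℤˣ) : ℤ)) =
      Function.update (fun j => (X j : ℤ)) i (z : ℤ) := by
    ext j
    rcases eq_or_ne j i with rfl | h <;> simp [*]
  rw [magn, h, Finset.sum_update_of_mem (Finset.mem_univ i), magn,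
    ← Finset.add_sum_erase _ _ (Finset.mem_univ i), Finset.sdiff_singleton_eq_erase]
  ring

theorem units_cases (z : ℤˣ) : (z : ℤ) = 1 ∨ (z : ℤ) = -1 := by
  rcases Int.units_eq_one_or z with rfl | rfl <;> simp

theorem abs_units (z : ℤˣ) : |(z : ℤ)| = 1 := by
  rcases units_cases z with h | h <;> rw [h] <;> rfl

theorem units_ne_iff {a b : ℤˣ} : a ≠ b ↔ a = -b := by
  revert a b
  decide

theorem units_eq_or (a b : ℤˣ) : a = b ∨ a = -b := by
  revert a b
  decide

theorem units_neg_ne (a : ℤˣ) : -a ≠ a := by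
  revert a
  decide

theorem abs_magn_le (X : Fin N → ℤˣ) : |magn X| ≤ N := by
  refine (Finset.abs_sum_le_sum_abs _ _).trans ?_
  rw [Finset.sum_congr rfl fun i _ => abs_units (X i)]
  simp

/-- The number of spins that differ from `e`, in terms of the magnetization. -/
theorem mul_magn (X : Fin N → ℤˣ) (e : ℤˣ) :
    (e : ℤ) * magn X = N - 2 * (Finset.univ.filter fun i => X i ≠ e).card := by
  have h : ∀ i, (e : ℤ) * X i = 1 - 2 * if X i ≠ e then 1 else 0 := fun i => by
    generalize X i = a
    revert a e
    decide
  rw [magn, Finset.mul_sum, Finset.sum_congr rfl fun i _ => h i, Finset.sum_sub_distrib,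
    ← Finset.mul_sum, Finset.sum_boole]
  simp

theorem odd_magn (hN : Odd N) (X : Fin N → ℤˣ) : Odd (magn X) := by
  have h := mul_magn X 1
  obtain ⟨k, rfl⟩ := hN
  refine ⟨k - (Finset.univ.filter fun i => X i ≠ 1).card, ?_⟩
  push_cast at h
  linarith

theorem one_le_abs_magn (hN : Odd N) (X : Fin N → ℤˣ) : 1 ≤ |magn X| :=
  Int.one_le_abs fun h => by simpa [h] using odd_magn hN X

variable (σ : State N) (i : Fin N) (z : ℤˣ)

theorem sumX_eq_magn : sumX σ = magn (σ ∘ Sum.inl) := rfl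

theorem sumY_eq_magn : sumY σ = magn (σ ∘ Sum.inr) := rfl

theorem sumX_update_inl :
    sumX (Function.update σ (Sum.inl i) z) = sumX σ - σ (Sum.inl i) + z := by
  rw [sumX_eq_magn, Sum.update_inl_comp_inl, magn_update]
  rfl

theorem sumY_update_inr :
    sumY (Function.update σ (Sum.inr i) z) = sumY σ - σ (Sum.inr i) + z := by
  rw [sumY_eq_magn, Sum.update_inr_comp_inr, magn_update]
  rfl

theorem sumX_update_inr : sumX (Function.update σ (Sum.inr i) z) = sumX σ := by
  rw [sumX_eq_magn, Sum.update_inr_comp_inl, sumX_eq_magn]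

theorem sumY_update_inl : sumY (Function.update σ (Sum.inl i) z) = sumY σ := by
  rw [sumY_eq_magn, Sum.update_inl_comp_inr, sumY_eq_magn]

end Magnetization

/-! ### Conditional laws of the two banks -/

section Conditional

variable {N : ℕ} (M₁ M₂ β : ℝ)

theorem energyY_nonneg (hM₂ : 0 ≤ M₂) (hβ : 0 ≤ β) (σ : State N) : 0 ≤ energyY M₂ β σ := by
  unfold energyY
  split_ifs <;> positivity

/-- A variable of the first bank whose neighbours sum to zero is resampled uniformly. -/
theorem cond_inl_eq_half {v : State N} {i : Fin N} (hs : sumX v - v (Sum.inl i) = 0) (z : ℤˣ) :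
    (cond M₁ M₂ β (Sum.inl i) v z).toReal = 1 / 2 := by
  rw [cond_apply M₁ M₂ β _ v z rfl rfl]
  have h : ∀ w : ℤˣ, |sumX (Function.update v (Sum.inl i) w)| = 1 := fun w => by
    rw [sumX_update_inl, hs, zero_add]
    exact abs_units w
  have h' : ∀ w : ℤˣ, |(sumX (Function.update v (Sum.inl i) w) : ℝ)| = 1 := fun w => by
    exact_mod_cast congrArg (Int.cast : ℤ → ℝ) (h w)
  simp only [energyX, energyY, h, h', if_true, sumY_update_inl, sub_self, Real.exp_zero]
  norm_num

/-- A variable of the first bank is unlikely to be set to the sign of the sum of the others. -/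
theorem cond_inl_le (hN : Odd N) (hM₂ : 0 ≤ M₂) (hβ : 0 ≤ β) {v : State N}
    {i : Fin N} {z : ℤˣ} (hs : 0 < (z : ℤ) * (sumX v - v (Sum.inl i))) :
    (cond M₁ M₂ β (Sum.inl i) v z).toReal ≤ Real.exp (M₂ * N ^ 2 - 2 * M₁) := by
  rw [cond_apply M₁ M₂ β _ v z rfl rfl]
  have hodd : Odd (sumX v) := odd_magn hN _
  set s := sumX v - v (Sum.inl i) with hs'
  -- The magnetization is odd, so `s` is even, and it is nonzero. Aligning with `s` therefore gives
  -- magnetization at least `3` in absolute value, where the second bank has coupling `M₂`; the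
  -- opposite choice saves `2 * M₁`.
  have h2 : 2 ≤ |s| ∧ |s + z| = |s| + 1 ∧ |s + (-z : ℤˣ)| = |s| - 1 := by
    obtain ⟨k, hk⟩ := hodd
    rcases units_cases z with h | h <;> rcases units_cases (v (Sum.inl i)) with h' | h' <;>
      rw [Units.val_neg, h] <;> rw [h] at hs <;> rw [h'] at hs' <;>
      rcases abs_cases s with ⟨h₁, h₂⟩ | ⟨h₁, h₂⟩ <;>
      rw [h₁] <;> refine ⟨by omega, ?_, ?_⟩ <;> first
      | (rw [abs_of_nonneg] <;> omega)
      | (rw [abs_of_nonpos] <;> omega)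
  obtain ⟨h2, hz, hz'⟩ := h2
  have eX : energyX M₁ (Function.update v (Sum.inl i) z) = -M₁ * (|s| + 1 : ℤ) := by
    rw [energyX, sumX_update_inl, ← hs', ← hz]
    push_cast
    rfl
  have eX' : energyX M₁ (Function.update v (Sum.inl i) (-z)) = -M₁ * (|s| - 1 : ℤ) := by
    rw [energyX, sumX_update_inl, ← hs', ← hz']
    push_cast
    rfl
  have eY : energyY M₂ β (Function.update v (Sum.inl i) z) ≤ M₂ * N ^ 2 := by
    have h1 : |sumX (Function.update v (Sum.inl i) z)| ≠ 1 := by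
      rw [sumX_update_inl, ← hs', hz]
      omega
    rw [energyY, if_neg h1]
    refine mul_le_mul_of_nonneg_left (sq_le_sq' ?_ ?_) hM₂ <;>
      have := abs_le.1 (abs_magn_le (Function.update v (Sum.inl i) z ∘ Sum.inr))
    · exact_mod_cast this.1
    · exact_mod_cast this.2
  have eY' := energyY_nonneg M₂ β hM₂ hβ (Function.update v (Sum.inl i) (-z))
  rw [eX, eX']
  push_cast
  rw [one_div, ← inv_inv (Real.exp (M₂ * _ - _)), ← Real.exp_neg]
  refine inv_anti₀ (Real.exp_pos _) ?_
  have : Real.exp (-(M₂ * N ^ 2 - 2 * M₁)) ≤ Real.exp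
      (-M₁ * (|(s : ℝ)| - 1) + energyY M₂ β (Function.update v (Sum.inl i) (-z)) -
        (-M₁ * (|(s : ℝ)| + 1) + energyY M₂ β (Function.update v (Sum.inl i) z))) :=
    Real.exp_le_exp.2 (by linarith)
  linarith

/-- The coupling strength of the second bank. -/
noncomputable def strength (v : State N) : ℝ := if |sumX v| = 1 then β / N else M₂

theorem cond_inr (v : State N) (i : Fin N) (z : ℤˣ) :
    (cond M₁ M₂ β (Sum.inr i) v z).toReal =
      1 / (1 + Real.exp (-(4 * strength M₂ β v * ((z : ℤ) * (sumY v - v (Sum.inr i)) : ℤ)))) := by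
  rw [cond_apply M₁ M₂ β _ v z rfl rfl]
  have hX : ∀ w, energyX M₁ (Function.update v (Sum.inr i) w) = energyX M₁ v := fun w => by
    rw [energyX, sumX_update_inr, energyX]
  have hY : ∀ w, energyY M₂ β (Function.update v (Sum.inr i) w) =
      strength M₂ β v * ((sumY v - v (Sum.inr i) : ℤ) + (w : ℤ) : ℝ) ^ 2 := fun w => by
    rw [energyY, sumX_update_inr, sumY_update_inr, strength]
    push_cast
    split_ifs <;> rfl
  rw [hX, hX, hY, hY]
  congr 3
  rw [Units.val_neg]
  push_cast
  ring

end Conditional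

/-! ### Hamming distance and updates -/

section Hamming

variable {ι S : Type*} [Fintype ι] [DecidableEq ι] [DecidableEq S]

theorem hammingDist_update_same_add (x y : ι → S) (i : ι) (a : S) :
    hammingDist (Function.update x i a) (Function.update y i a) + (if x i ≠ y i then 1 else 0) =
      hammingDist x y := by
  have h : (Finset.univ.filter fun j => Function.update x i a j ≠ Function.update y i a j) =
      (Finset.univ.filter fun j => x j ≠ y j).erase i := by
    ext j
    rcases eq_or_ne j i with rfl | h <;> simp [*]
  unfold hammingDist
  rw [h, Finset.card_erase_eq_ite]
  by_cases hi : x i = y i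
  · simp [hi]
  · have : 0 < (Finset.univ.filter fun j => x j ≠ y j).card :=
      Finset.card_pos.2 ⟨i, by simpa using hi⟩
    rw [if_pos (by simpa using hi), if_pos hi]
    omega

theorem hammingDist_update_update_le (x y : ι → S) (i : ι) (a b : S) :
    hammingDist (Function.update x i a) (Function.update y i b) +
      (if x i ≠ y i then 1 else 0) ≤ hammingDist x y + 1 := by
  have h₁ := hammingDist_update_same_add x y i a
  have h₂ := hammingDist_triangle (Function.update x i a) (Function.update y i a)
    (Function.update y i b)
  have h₃ : hammingDist (Function.update y i a) (Function.update y i b) ≤ 1 := by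
    unfold hammingDist
    refine Finset.card_le_one.2 fun j hj k hk => ?_
    have aux : ∀ j ∈ Finset.univ.filter
        (fun j => Function.update y i a j ≠ Function.update y i b j), j = i := fun j hj => by
      by_contra hne
      simp [hne] at hj
    rw [aux j hj, aux k hk]
  omega

theorem hammingDist_update_left_add_one {x y : ι → S} {i : ι} (h : x i ≠ y i) :
    hammingDist (Function.update x i (y i)) y + 1 = hammingDist x y := by
  have := hammingDist_update_same_add x y i (y i)
  rwa [if_pos h, Function.update_eq_self] at this

theorem hammingDist_update_right_add_one {x y : ι → S} {i : ι} (h : x i ≠ y i) :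
    hammingDist x (Function.update y i (x i)) + 1 = hammingDist x y := by
  have := hammingDist_update_same_add x y i (x i)
  rwa [if_pos h, Function.update_eq_self] at this

end Hamming

/-! ### The first bank with infinitely strong restoring force -/

section FirstBank

variable {N : ℕ}

/-- The value given to variable `i` when the sum of the others is pushed back towards `0`;
the fair coin `ξ` decides if that sum is `0`. -/
def idealValue (X : Fin N → ℤˣ) (i : Fin N) (ξ : ℤˣ) : ℤˣ :=
  if magn X - X i = 0 then ξ else if 0 < magn X - X i then -1 else 1

/-- The first bank after variable `i` has been set to its `idealValue`. -/
def idealMove (X : Fin N → ℤˣ) (i : Fin N) (ξ : ℤˣ) : Fin N → ℤˣ :=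
  Function.update X i (idealValue X i ξ)

/-- By parity, magnetization beyond `±1` is at least `3` in absolute value, so the sum without a
majority spin keeps its sign and that spin is flipped. In every other case the absolute value does
not increase. -/
theorem abs_magn_idealMove_le (hN : Odd N) (X : Fin N → ℤˣ) (i : Fin N) (ξ : ℤˣ) :
    |magn (idealMove X i ξ)| ≤
      |magn X| - if 1 < |magn X| ∧ 0 < (X i : ℤ) * magn X then 2 else 0 := by
  obtain ⟨k, hk⟩ := odd_magn hN X
  rw [idealMove, magn_update, idealValue]
  generalize magn X = T at *
  rcases units_cases (X i) with h | h <;> rcases units_cases ξ with h' | h' <;>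
    rw [h] <;> split_ifs <;>
    simp only [h', Units.val_one, Units.val_neg] <;>
    rw [abs_le] <;> rcases abs_cases T with ⟨h₄, h₅⟩ | ⟨h₄, h₅⟩ <;> omega

/-- On the layer of magnetization `e`, a spin `e` has neighbours of sum zero and obeys the coin,
while a spin `-e` sees the sum `2 e` and stays. So the coin alone decides whether anything can move.
-/
theorem idealMove_self {X : Fin N → ℤˣ} {e : ℤˣ} (h : magn X = e) (i : Fin N) :
    idealMove X i e = X := by
  refine (congrArg (Function.update X i) ?_).trans (Function.update_eq_self i X)
  rw [idealValue, h]
  generalize X i = a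
  clear h
  revert a e
  decide

theorem idealMove_neg {X : Fin N → ℤˣ} {e : ℤˣ} (h : magn X = e) (i : Fin N) :
    idealMove X i (-e) = Function.update X i (-e) := by
  refine congrArg (Function.update X i) ?_
  rw [idealValue, h]
  generalize X i = a
  clear h
  revert a e
  decide

theorem magn_update_neg {X : Fin N → ℤˣ} {e : ℤˣ} (h : magn X = e) (i : Fin N) :
    magn (Function.update X i (-e)) = (-X i : ℤˣ) := by
  rw [magn_update, h]
  push_cast
  ring

/-- The distance on the first bank that the coupling contracts. -/
noncomputable def potX (X X' : Fin N → ℤˣ) : ℝ :=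
  12 * ((|magn X| - 1 : ℤ) + (|magn X'| - 1 : ℤ)) + 8 * (if magn X = magn X' then 0 else 1) +
    hammingDist X X'

/-- Summed over the indices, the average of `potX` after coupled moves with the same coin, where
the second copy uses the index `σ i` if the first one uses `i`. -/
noncomputable def coupledSum (σ : Equiv.Perm (Fin N)) (X X' : Fin N → ℤˣ) : ℝ :=
  ∑ i, (∑ ξ, potX (idealMove X i ξ) (idealMove X' (σ i) ξ)) / 2

theorem le_sum_majority {X : Fin N → ℤˣ} (h : 1 < |magn X|) :
    (N : ℝ) ≤ ∑ i, if 1 < |magn X| ∧ 0 < (X i : ℤ) * magn X then (2 : ℝ) else 0 := by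
  obtain ⟨e, he⟩ : ∃ e : ℤˣ, 0 < (e : ℤ) * magn X := by
    rcases lt_or_ge 0 (magn X) with h' | h'
    · exact ⟨1, by simpa using h'⟩
    · refine ⟨-1, ?_⟩
      rw [abs_of_nonpos h'] at h
      push_cast
      omega
  have h₁ := mul_magn X e
  have h₂ := Finset.card_filter_add_card_filter_not (s := Finset.univ) (fun i => X i = e)
  rw [Finset.card_univ, Fintype.card_fin] at h₂
  -- The majority sign is carried by at least half of the sites, and each of them contributes `2`.
  have h₃ : N ≤ (Finset.univ.filter fun i => X i = e).card * 2 := by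
    simp only [ne_eq] at h₁
    omega
  calc (N : ℝ) ≤ ∑ i, if X i = e then (2 : ℝ) else 0 := by
        rw [← Finset.sum_filter, Finset.sum_const, nsmul_eq_mul]
        exact_mod_cast h₃
    _ ≤ _ := Finset.sum_le_sum fun i _ => by
        split_ifs with h₄ h₅
        · rfl
        · exact absurd ⟨h, h₄ ▸ he⟩ h₅
        · exact zero_le_two
        · rfl

/-- While one copy is away from the two middle layers, the distance drops by a constant. -/
theorem coupledSum_refl_le (hN : Odd N) {X X' : Fin N → ℤˣ} (h : 1 < |magn X| ∨ 1 < |magn X'|) :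
    coupledSum (Equiv.refl _) X X' ≤ N * potX X X' - 3 * N := by
  set a : Fin N → ℝ := fun i => if 1 < |magn X| ∧ 0 < (X i : ℤ) * magn X then 2 else 0 with ha
  set a' : Fin N → ℝ :=
    fun i => if 1 < |magn X'| ∧ 0 < (X' i : ℤ) * magn X' then 2 else 0 with ha'
  have hsum : (N : ℝ) ≤ ∑ i, (a i + a' i) := by
    have h0 : 0 ≤ ∑ i, a i := Finset.sum_nonneg fun i _ => by rw [ha]; positivity
    have h0' : 0 ≤ ∑ i, a' i := Finset.sum_nonneg fun i _ => by rw [ha']; positivity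
    rw [Finset.sum_add_distrib]
    rcases h with h | h
    · linarith [le_sum_majority h]
    · linarith [le_sum_majority h]
  -- A move costs at most `8` in the indicator and `1` in the Hamming distance, hence `9`. The
  -- weight `12` is chosen so that the drop of the magnetizations, at least `N` summed over the
  -- indices, beats this by `3 * N`.
  have hterm : ∀ i ξ, potX (idealMove X i ξ) (idealMove X' i ξ) ≤
      potX X X' + 9 - 12 * (a i + a' i) := fun i ξ => by
    have h₁ : (|magn (idealMove X i ξ)| : ℝ) ≤ |magn X| - a i := by
      have := abs_magn_idealMove_le hN X i ξ
      rw [← Int.cast_le (R := ℝ)] at this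
      simpa [ha] using this
    have h₂ : (|magn (idealMove X' i ξ)| : ℝ) ≤ |magn X'| - a' i := by
      have := abs_magn_idealMove_le hN X' i ξ
      rw [← Int.cast_le (R := ℝ)] at this
      simpa [ha'] using this
    have h₃ : (hammingDist (idealMove X i ξ) (idealMove X' i ξ) : ℝ) ≤ hammingDist X X' + 1 := by
      exact_mod_cast (Nat.le_add_right _ _).trans
        (hammingDist_update_update_le X X' i (idealValue X i ξ) (idealValue X' i ξ))
    have h₄ : (if magn (idealMove X i ξ) = magn (idealMove X' i ξ) then (0 : ℝ) else 1) ≤ 1 := by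
      split_ifs <;> norm_num
    have h₅ : (0 : ℝ) ≤ if magn X = magn X' then (0 : ℝ) else 1 := by positivity
    unfold potX
    push_cast at h₁ h₂ ⊢
    linarith
  calc coupledSum (Equiv.refl _) X X' ≤ ∑ i, (potX X X' + 9 - 12 * (a i + a' i)) := by
        refine Finset.sum_le_sum fun i _ => ?_
        rw [sum_units _ 1]
        have h₁ := hterm i 1
        have h₂ := hterm i (-1)
        simp only [Equiv.refl_apply]
        linarith
    _ ≤ _ := by
        rw [Finset.sum_sub_distrib, ← Finset.mul_sum, Finset.sum_const, Finset.card_univ,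
          Fintype.card_fin, nsmul_eq_mul]
        linarith

theorem potX_of_abs_eq_one {X X' : Fin N → ℤˣ} (h : |magn X| = 1) (h' : |magn X'| = 1) :
    potX X X' = 8 * (if magn X = magn X' then 0 else 1) + hammingDist X X' := by
  rw [potX, h, h']
  simp

/-- In the two middle layers, the magnetizations meet at a constant rate. -/
theorem coupledSum_refl_le_of_neg {X X' : Fin N → ℤˣ} {e : ℤˣ} (h : magn X = e)
    (h' : magn X' = (-e : ℤˣ)) :
    coupledSum (Equiv.refl _) X X' ≤ N * potX X X' - 3 * N := by
  have habs : |magn X| = 1 := by rw [h, abs_units]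
  have habs' : |magn X'| = 1 := by rw [h', abs_units]
  have hne : ¬magn X = magn X' := by
    rw [h, h', Units.val_inj]
    exact (units_neg_ne e).symm
  have hpot : potX X X' = 8 + hammingDist X X' := by
    rw [potX_of_abs_eq_one habs habs', if_neg hne, mul_one]
  have c : ((Finset.univ.filter fun i => X i ≠ e).card : ℝ) = (N - 1) / 2 := by
    have := mul_magn X e
    rw [h, ← Units.val_mul, Int.units_mul_self, Units.val_one, ← Int.cast_inj (α := ℝ)] at this
    push_cast at this
    linarith
  have c' : ((Finset.univ.filter fun i => X' i ≠ -e).card : ℝ) = (N - 1) / 2 := by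
    have := mul_magn X' (-e)
    rw [h', ← Units.val_mul, Int.units_mul_self, Units.val_one, ← Int.cast_inj (α := ℝ)] at this
    push_cast at this
    linarith
  have ham : ∀ i a b, (hammingDist (Function.update X i a) (Function.update X' i b) : ℝ) ≤
      hammingDist X X' + 1 := fun i a b => by
    exact_mod_cast (Nat.le_add_right _ _).trans (hammingDist_update_update_le X X' i a b)
  -- The coin `e` can move only the second copy, the coin `-e` only the first. The moving copy joins
  -- the layer of the other one exactly if the chosen spin is of its majority sign, as for `(N + 1)
  -- / 2` indices.
  have t₁ : ∀ i, potX (idealMove X i e) (idealMove X' i e) ≤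
      hammingDist X X' + 1 + 8 * (if X' i ≠ -e then 1 else 0) := fun i => by
    have e₂ := idealMove_neg h' i
    have m₂ := magn_update_neg h' i
    rw [neg_neg] at e₂ m₂
    rw [idealMove_self h, e₂, potX_of_abs_eq_one habs (by rw [m₂, abs_units]), h, m₂]
    simp only [Units.val_inj, eq_comm (a := e), neg_eq_iff_eq_neg, ne_eq, ite_not]
    have := ham i (X i) e
    rw [Function.update_eq_self] at this
    linarith
  have t₂ : ∀ i, potX (idealMove X i (-e)) (idealMove X' i (-e)) ≤
      hammingDist X X' + 1 + 8 * (if X i ≠ e then 1 else 0) := fun i => by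
    rw [idealMove_self h', idealMove_neg h,
      potX_of_abs_eq_one (by rw [magn_update_neg h, abs_units]) habs', h', magn_update_neg h]
    simp only [Units.val_inj, neg_inj, ne_eq, ite_not]
    have := ham i (-e) (X' i)
    rw [Function.update_eq_self] at this
    linarith
  calc coupledSum (Equiv.refl _) X X'
      ≤ ∑ i : Fin N, ((hammingDist X X' + 1 : ℝ) + 4 * (if X i ≠ e then 1 else 0) +
          4 * (if X' i ≠ -e then 1 else 0)) := by
        refine Finset.sum_le_sum fun i _ => ?_
        rw [sum_units _ e]
        have h₁ := t₁ i
        have h₂ := t₂ i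
        simp only [Equiv.refl_apply]
        linarith
    _ ≤ _ := by
        rw [Finset.sum_add_distrib, Finset.sum_add_distrib, ← Finset.mul_sum, ← Finset.mul_sum,
          Finset.sum_boole, Finset.sum_boole, c, c', Finset.sum_const, Finset.card_univ,
          Fintype.card_fin, nsmul_eq_mul, hpot]
        linarith

theorem card_filter_and_ne_comm {X X' : Fin N → ℤˣ} (h : magn X = magn X') (e : ℤˣ) :
    (Finset.univ.filter fun i => X i = e ∧ X' i ≠ e).card =
      (Finset.univ.filter fun i => X i ≠ e ∧ X' i = e).card := by
  have h₁ := mul_magn X e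
  have h₂ := mul_magn X' e
  have hc : (Finset.univ.filter fun i => X i ≠ e).card =
      (Finset.univ.filter fun i => X' i ≠ e).card := by
    rw [h] at h₁
    omega
  have := Finset.card_sdiff_comm hc.symm
  convert this using 2 <;> ext i <;> simp [and_comm]

/-- Two configurations with equal magnetization are permutations of each other, by a permutation
that fixes all the indices at which they agree. -/
theorem exists_perm {X X' : Fin N → ℤˣ} (h : magn X = magn X') :
    ∃ σ : Equiv.Perm (Fin N), (∀ i, X' (σ i) = X i) ∧ ∀ i, X i = X' i → σ i = i := by
  classical
  set P := Finset.univ.filter fun i => X i = 1 ∧ X' i ≠ 1 with hP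
  set Q := Finset.univ.filter fun i => X i ≠ 1 ∧ X' i = 1 with hQ
  -- Equal magnetizations give equally many disagreements of either type, so any bijection between
  -- the two types serves. Swapping along it is an involution.
  let f : P ≃ Q := Finset.equivOfCardEq (card_filter_and_ne_comm h 1)
  let s : Fin N → Fin N := fun i =>
    if hi : i ∈ P then f ⟨i, hi⟩ else if hi' : i ∈ Q then f.symm ⟨i, hi'⟩ else i
  have sP : ∀ i (hi : i ∈ P), s i = f ⟨i, hi⟩ := fun i hi => dif_pos hi
  have hPQ : ∀ i ∈ Q, i ∉ P := fun i hi hi' => by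
    simp only [hP, hQ, Finset.mem_filter] at hi hi'
    exact hi.2.1 hi'.2.1
  have sQ : ∀ i (hi : i ∈ Q), s i = f.symm ⟨i, hi⟩ := fun i hi => by
    simp only [s, dif_neg (hPQ i hi), dif_pos hi]
  have sR : ∀ i, i ∉ P → i ∉ Q → s i = i := fun i hi hi' => by
    simp only [s, dif_neg hi, dif_neg hi']
  have hs : Function.Involutive s := fun i => by
    by_cases hi : i ∈ P
    · rw [sP i hi, sQ _ (f ⟨i, hi⟩).2]
      simp
    · by_cases hi' : i ∈ Q
      · rw [sQ i hi', sP _ (f.symm ⟨i, hi'⟩).2]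
        simp
      · rw [sR i hi hi', sR i hi hi']
  refine ⟨hs.toPerm, fun i => ?_, fun i hi => sR i ?_ ?_⟩
  · change X' (s i) = X i
    by_cases hi : i ∈ P
    · have h₁ := (f ⟨i, hi⟩).2
      rw [sP i hi]
      simp only [hP, hQ, Finset.mem_filter] at hi h₁
      rw [hi.2.1, h₁.2.2]
    · by_cases hi' : i ∈ Q
      · have h₁ := (f.symm ⟨i, hi'⟩).2
        rw [sQ i hi']
        simp only [hP, hQ, Finset.mem_filter] at hi' h₁
        rw [units_ne_iff.1 hi'.2.1, units_ne_iff.1 h₁.2.2]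
      · rw [sR i hi hi']
        simp only [hP, hQ, Finset.mem_filter, Finset.mem_univ, true_and] at hi hi'
        generalize X i = a at *
        generalize X' i = b at *
        revert a b
        decide
  · simp [hP, hi]
  · simp [hQ, hi]

/-- On one middle layer, the Hamming distance contracts. -/
theorem exists_coupledSum_le {X X' : Fin N → ℤˣ} {e : ℤˣ} (h : magn X = e) (h' : magn X' = e) :
    ∃ σ, coupledSum σ X X' ≤ N * potX X X' - potX X X' / 2 := by
  obtain ⟨σ, hσ, hfix⟩ := exists_perm (h.trans h'.symm)
  refine ⟨σ, ?_⟩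
  have habs : |magn X| = 1 := by rw [h, abs_units]
  have habs' : |magn X'| = 1 := by rw [h', abs_units]
  have hpot : potX X X' = hammingDist X X' := by
    rw [potX_of_abs_eq_one habs habs', if_pos (h.trans h'.symm), mul_zero, zero_add]
  have hcard : (hammingDist X X' : ℝ) =
      2 * (Finset.univ.filter fun i => X i = e ∧ X' i ≠ e).card := by
    have h₁ : hammingDist X X' = (Finset.univ.filter fun i => X i = e ∧ X' i ≠ e).card +
        (Finset.univ.filter fun i => X i ≠ e ∧ X' i = e).card := by
      rw [← Finset.card_union_of_disjoint, ← Finset.filter_or]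
      · unfold hammingDist
        congr 1
        ext i
        simp only [Finset.mem_filter, Finset.mem_univ, true_and]
        generalize X i = a
        generalize X' i = b
        clear * -
        revert a b e
        decide
      · exact Finset.disjoint_filter.2 fun i _ h₁ h₂ => h₂.1 h₁.1
    rw [h₁, ← card_filter_and_ne_comm (h.trans h'.symm)]
    push_cast
    ring
  -- Only the coin `-e` moves anything. It sets site `i` in one copy and the matched site `σ i` in
  -- the other to `-e`; the magnetizations stay equal because the old values agree. If `i` was a
  -- disagreement with first spin `e`, both `i` and `σ i` are repaired. Half of all disagreements
  -- are of this type.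
  have term : ∀ i, potX (idealMove X i (-e)) (idealMove X' (σ i) (-e)) =
      hammingDist X X' - 2 * (if X i = e ∧ X' i ≠ e then 1 else 0) := fun i => by
    rw [idealMove_neg h, idealMove_neg h', potX_of_abs_eq_one (by rw [magn_update_neg h, abs_units])
      (by rw [magn_update_neg h', abs_units]), magn_update_neg h, magn_update_neg h', hσ,
      if_pos rfl, mul_zero, zero_add]
    by_cases hi : X i = X' i
    · rw [hfix i hi, if_neg (fun h => h.2 (hi ▸ h.1)), mul_zero, sub_zero]
      have := hammingDist_update_same_add X X' i (-e)
      rw [if_neg (not_not.2 hi)] at this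
      exact_mod_cast this
    · rcases units_eq_or (X i) e with hie | hie
      · have hie' : X' i = -e := units_ne_iff.1 (hie ▸ Ne.symm hi)
        have hne : σ i ≠ i := fun h₁ => hi (by rw [← hσ i, h₁])
        have hj : X (σ i) ≠ X' (σ i) := fun h₁ => hne (σ.injective (hfix _ h₁))
        have hj' : X (σ i) = -e := units_ne_iff.1 (by rwa [hσ, hie] at hj)
        have h₁ := hammingDist_update_left_add_one hi
        rw [hie'] at h₁
        have hj'' : Function.update X i (-e) (σ i) = -e := by rw [Function.update_of_ne hne, hj']
        have h₂ := hammingDist_update_right_add_one (x := Function.update X i (-e)) (y := X')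
          (i := σ i) (by rw [Function.update_of_ne hne]; exact hj)
        rw [hj''] at h₂
        rw [if_pos ⟨hie, by rw [hie']; exact units_neg_ne e⟩, ← h₁, ← h₂]
        push_cast
        ring
      · rw [if_neg (fun h => units_neg_ne e (hie.symm.trans h.1)), mul_zero, sub_zero]
        have h₁ : Function.update X i (-e) = X := by rw [← hie, Function.update_eq_self]
        have h₂ : Function.update X' (σ i) (-e) = X' := by
          rw [← hie, ← hσ i, Function.update_eq_self]
        rw [h₁, h₂]
  have hsum : coupledSum σ X X' =
      ∑ i, ((hammingDist X X' : ℝ) - (if X i = e ∧ X' i ≠ e then 1 else 0)) := by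
    refine Finset.sum_congr rfl fun i _ => ?_
    rw [sum_units _ e, term, idealMove_self h, idealMove_self h', hpot]
    ring
  rw [hsum, Finset.sum_sub_distrib, Finset.sum_boole, Finset.sum_const, Finset.card_univ,
    Fintype.card_fin, nsmul_eq_mul, hpot]
  linarith

end FirstBank

/-! ### Contraction of sequential Gibbs sampling -/

theorem abs_logistic_sub_le (a b : ℝ) :
    |1 / (1 + Real.exp a) - 1 / (1 + Real.exp b)| ≤ |a - b| := by
  wlog h : a ≤ b generalizing a b
  · rw [abs_sub_comm, abs_sub_comm a]
    exact this b a (le_of_not_ge h)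
  have ha := Real.exp_pos a
  have hb := Real.exp_pos b
  have hab := Real.exp_le_exp.2 h
  have h₁ : Real.exp a = Real.exp (a - b) * Real.exp b := by rw [← Real.exp_add, sub_add_cancel]
  have h₂ := Real.add_one_le_exp (a - b)
  rw [abs_of_nonneg (sub_nonneg.2 (one_div_le_one_div_of_le (by positivity) (by linarith))),
    abs_of_nonpos (by linarith), div_sub_div _ _ (by positivity) (by positivity),
    div_le_iff₀ (by positivity)]
  have h₃ : Real.exp b - Real.exp a ≤ (b - a) * Real.exp b := by
    rw [h₁]
    nlinarith
  nlinarith [mul_nonneg (sub_nonneg.2 h) ha.le, mul_nonneg (sub_nonneg.2 h) (mul_pos ha hb).le]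

section Contraction

variable {N : ℕ}

theorem abs_magn_sub_le (X X' : Fin N → ℤˣ) : |magn X - magn X'| ≤ 2 * hammingDist X X' := by
  have h : ∀ i, |(X i : ℤ) - X' i| ≤ 2 * if X i ≠ X' i then 1 else 0 := fun i => by
    generalize X i = a
    generalize X' i = b
    revert a b
    decide
  rw [magn, magn, ← Finset.sum_sub_distrib]
  refine (Finset.abs_sum_le_sum_abs _ _).trans ((Finset.sum_le_sum fun i _ => h i).trans_eq ?_)
  rw [← Finset.mul_sum, Finset.sum_boole]
  rfl

/-- The distance on states that the coupling contracts. -/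
noncomputable def pot (x y : State N) : ℝ :=
  potX (x ∘ Sum.inl) (y ∘ Sum.inl) + hammingDist (x ∘ Sum.inr) (y ∘ Sum.inr)

/-- This bound turns a drop by a constant into a drop proportional to `pot`, and so sets the rate `1
/ (34 * N)`. -/
theorem pot_le [NeZero N] (x y : State N) : pot x y ≤ 34 * N := by
  have h₁ : (|magn (x ∘ Sum.inl)| : ℝ) ≤ N := by exact_mod_cast abs_magn_le (x ∘ Sum.inl)
  have h₂ : (|magn (y ∘ Sum.inl)| : ℝ) ≤ N := by exact_mod_cast abs_magn_le (y ∘ Sum.inl)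
  have h₃ : (hammingDist (x ∘ Sum.inl) (y ∘ Sum.inl) : ℝ) ≤ N := by
    have := hammingDist_le_card_fintype (x := x ∘ Sum.inl) (y := y ∘ Sum.inl)
    rw [Fintype.card_fin] at this
    exact_mod_cast this
  have h₄ : (hammingDist (x ∘ Sum.inr) (y ∘ Sum.inr) : ℝ) ≤ N := by
    have := hammingDist_le_card_fintype (x := x ∘ Sum.inr) (y := y ∘ Sum.inr)
    rw [Fintype.card_fin] at this
    exact_mod_cast this
  have h₅ : (if magn (x ∘ Sum.inl) = magn (y ∘ Sum.inl) then (0 : ℝ) else 1) ≤ 1 := by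
    split_ifs <;> norm_num
  have h₆ : (1 : ℝ) ≤ N := by exact_mod_cast NeZero.one_le
  unfold pot potX
  push_cast at h₁ h₂ ⊢
  linarith

theorem hammingDist_le_potX (hN : Odd N) (X X' : Fin N → ℤˣ) : (hammingDist X X' : ℝ) ≤ potX X X' := by
  have h₁ : (1 : ℝ) ≤ |magn X| := by exact_mod_cast one_le_abs_magn hN X
  have h₂ : (1 : ℝ) ≤ |magn X'| := by exact_mod_cast one_le_abs_magn hN X'
  have h₅ : (0 : ℝ) ≤ if magn X = magn X' then (0 : ℝ) else 1 := by positivity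
  unfold potX
  push_cast at h₁ h₂ ⊢
  linarith

theorem pot_nonneg (hN : Odd N) (x y : State N) : 0 ≤ pot x y :=
  add_nonneg ((Nat.cast_nonneg _).trans (hammingDist_le_potX hN _ _)) (Nat.cast_nonneg _)

theorem one_le_pot (hN : Odd N) {x y : State N} (h : x ≠ y) : 1 ≤ pot x y := by
  have h₁ := hammingDist_le_potX hN (x ∘ Sum.inl) (y ∘ Sum.inl)
  have h₂ : 1 ≤ hammingDist (x ∘ Sum.inl) (y ∘ Sum.inl) +
      hammingDist (x ∘ Sum.inr) (y ∘ Sum.inr) := by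
    by_contra! h₃
    have hl : x ∘ Sum.inl = y ∘ Sum.inl := hammingDist_eq_zero.1 (by omega)
    have hr : x ∘ Sum.inr = y ∘ Sum.inr := hammingDist_eq_zero.1 (by omega)
    refine h (funext fun i => ?_)
    rcases i with i | i
    · exact congrFun hl i
    · exact congrFun hr i
  have h₃ : (1 : ℝ) ≤ hammingDist (x ∘ Sum.inl) (y ∘ Sum.inl) +
      hammingDist (x ∘ Sum.inr) (y ∘ Sum.inr) := by exact_mod_cast h₂
  unfold pot
  linarith

variable (M₁ M₂ β : ℝ)

/-- Sequential Gibbs sampling with infinitely strong restoring force on the first bank, as an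
operator on functions. -/
noncomputable def idealOp (f : State N → ℝ) (x : State N) : ℝ :=
  (∑ i, (∑ ξ, f (Function.update x (Sum.inl i) (idealValue (x ∘ Sum.inl) i ξ))) / 2 +
    ∑ i, expect (cond M₁ M₂ β (Sum.inr i) x) fun z => f (Function.update x (Sum.inr i) z)) /
      (2 * N)

/-- A Dobrushin-type bound: the local field changes by at most twice the Hamming distance, and `8 *
β ≤ 1 / 4`. Summed over the `N` variables, new disagreements amount to at most a quarter of the old
ones. -/
theorem abs_cond_inr_sub_le (hβ : 0 ≤ β) (hβ' : β ≤ 1 / 32) {x y : State N} (hx : |sumX x| = 1)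
    (hy : |sumX y| = 1) (i : Fin N) :
    |(cond M₁ M₂ β (Sum.inr i) x 1).toReal - (cond M₁ M₂ β (Sum.inr i) y 1).toReal| ≤
      hammingDist (x ∘ Sum.inr) (y ∘ Sum.inr) / (4 * N) := by
  rw [cond_inr, cond_inr, strength, strength, if_pos hx, if_pos hy]
  refine (abs_logistic_sub_le _ _).trans ?_
  set Y := x ∘ Sum.inr with hY
  set Y' := y ∘ Sum.inr with hY'
  have h₁ : |(magn Y - Y i) - (magn Y' - Y' i)| ≤ 2 * hammingDist Y Y' := by
    have h₂ := abs_magn_sub_le (Function.update Y i 1) (Function.update Y' i 1)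
    rw [magn_update, magn_update, add_sub_add_right_eq_sub] at h₂
    refine h₂.trans ?_
    have := hammingDist_update_same_add Y Y' i 1
    omega
  have h₃ : (|((magn Y - Y i : ℤ) - (magn Y' - Y' i : ℤ) : ℝ)|) ≤ 2 * hammingDist Y Y' := by
    exact_mod_cast h₁
  have e₁ : sumY x - x (Sum.inr i) = magn Y - Y i := rfl
  have e₂ : sumY y - y (Sum.inr i) = magn Y' - Y' i := rfl
  rw [e₁, e₂, Units.val_one, one_mul, one_mul, neg_sub_neg, ← mul_sub, abs_mul, abs_sub_comm,
    abs_of_nonneg (by positivity)]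
  calc 4 * (β / N) * |((magn Y - Y i : ℤ) - (magn Y' - Y' i : ℤ) : ℝ)|
      ≤ 4 * (β / N) * (2 * hammingDist Y Y') := by gcongr
    _ = 8 * β * (hammingDist Y Y' / N) := by ring
    _ ≤ 1 / 4 * (hammingDist Y Y' / N) := by gcongr; linarith
    _ = _ := by ring

/-- Both copies update the same index under the maximal coupling of the new spins. The old
disagreement at that index is erased, and a new one arises with probability at most `c`. -/
theorem sum_inr_sub_le {f : State N → ℝ} {l η : ℝ} (hl : 0 ≤ l)
    (hf : ∀ x y, f x - f y ≤ l * pot x y + η) (x y : State N) (c : ℝ)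
    (hc : ∀ i, |(cond M₁ M₂ β (Sum.inr i) x 1).toReal -
      (cond M₁ M₂ β (Sum.inr i) y 1).toReal| ≤ c) :
    (∑ i, expect (cond M₁ M₂ β (Sum.inr i) x) fun z => f (Function.update x (Sum.inr i) z)) -
      (∑ i, expect (cond M₁ M₂ β (Sum.inr i) y) fun z => f (Function.update y (Sum.inr i) z)) ≤
      N * (l * pot x y + η) + l * (N * c - hammingDist (x ∘ Sum.inr) (y ∘ Sum.inr)) := by
  set Y := x ∘ Sum.inr with hY
  set Y' := y ∘ Sum.inr with hY'
  have hpot : ∀ i z w, pot (Function.update x (Sum.inr i) z) (Function.update y (Sum.inr i) w) =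
      pot x y - hammingDist Y Y' + hammingDist (Function.update Y i z) (Function.update Y' i w) :=
    fun i z w => by
      simp only [pot, Sum.update_inr_comp_inl, Sum.update_inr_comp_inr, ← hY, ← hY']
      ring
  have hterm : ∀ i, (expect (cond M₁ M₂ β (Sum.inr i) x)
        fun z => f (Function.update x (Sum.inr i) z)) -
      (expect (cond M₁ M₂ β (Sum.inr i) y) fun z => f (Function.update y (Sum.inr i) z)) ≤
      l * pot x y + η + l * c - l * (if Y i ≠ Y' i then 1 else 0) := fun i => by
    refine (expect_units_sub_le _ _
      (b := l * (pot x y - if Y i ≠ Y' i then 1 else 0) + η) (k := l)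
      (fun z => (hf _ _).trans ?_) (fun z w => (hf _ _).trans ?_)).trans ?_
    · rw [hpot, ← hammingDist_update_same_add Y Y' i z]
      push_cast
      linarith
    · rw [hpot]
      have h₁ : (hammingDist (Function.update Y i z) (Function.update Y' i w) : ℝ) +
          (if Y i ≠ Y' i then 1 else 0) ≤ hammingDist Y Y' + 1 := by
        exact_mod_cast hammingDist_update_update_le Y Y' i z w
      have := mul_le_mul_of_nonneg_left h₁ hl
      linarith
    · have := mul_le_mul_of_nonneg_left (hc i) hl
      linarith
  rw [← Finset.sum_sub_distrib]
  refine (Finset.sum_le_sum fun i _ => hterm i).trans_eq ?_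
  have hd : (hammingDist Y Y' : ℝ) = ∑ i, if Y i ≠ Y' i then 1 else 0 := by
    rw [Finset.sum_boole]
    rfl
  rw [Finset.sum_sub_distrib, ← Finset.mul_sum, ← hd, Finset.sum_const, Finset.card_univ,
    Fintype.card_fin, nsmul_eq_mul]
  ring

/-- The index is uniform, so the second copy may use `σ i` where the first uses `i`. -/
theorem sum_inl_sub_le {f : State N → ℝ} {l η : ℝ}
    (hf : ∀ x y, f x - f y ≤ l * pot x y + η) (x y : State N) (σ : Equiv.Perm (Fin N)) :
    (∑ i, (∑ ξ, f (Function.update x (Sum.inl i) (idealValue (x ∘ Sum.inl) i ξ))) / 2) -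
      (∑ i, (∑ ξ, f (Function.update y (Sum.inl i) (idealValue (y ∘ Sum.inl) i ξ))) / 2) ≤
      l * coupledSum σ (x ∘ Sum.inl) (y ∘ Sum.inl) +
        N * (l * hammingDist (x ∘ Sum.inr) (y ∘ Sum.inr) + η) := by
  rw [← Equiv.sum_comp σ fun i =>
    (∑ ξ, f (Function.update y (Sum.inl i) (idealValue (y ∘ Sum.inl) i ξ))) / 2,
    ← Finset.sum_sub_distrib]
  have hterm : ∀ i ξ, f (Function.update x (Sum.inl i) (idealValue (x ∘ Sum.inl) i ξ)) -
      f (Function.update y (Sum.inl (σ i)) (idealValue (y ∘ Sum.inl) (σ i) ξ)) ≤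
      l * potX (idealMove (x ∘ Sum.inl) i ξ) (idealMove (y ∘ Sum.inl) (σ i) ξ) +
        (l * hammingDist (x ∘ Sum.inr) (y ∘ Sum.inr) + η) := fun i ξ => by
    refine (hf _ _).trans_eq ?_
    simp only [pot, Sum.update_inl_comp_inl, Sum.update_inl_comp_inr, idealMove]
    ring
  calc _ ≤ ∑ i, (l * ((∑ ξ, potX (idealMove (x ∘ Sum.inl) i ξ)
          (idealMove (y ∘ Sum.inl) (σ i) ξ)) / 2) +
        (l * hammingDist (x ∘ Sum.inr) (y ∘ Sum.inr) + η)) := by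
        refine Finset.sum_le_sum fun i _ => ?_
        simp only [sum_units _ 1]
        linarith [hterm i 1, hterm i (-1)]
    _ = _ := by
        rw [Finset.sum_add_distrib, ← Finset.mul_sum, Finset.sum_const, Finset.card_univ,
          Fintype.card_fin, nsmul_eq_mul]
        rfl

theorem idealOp_sub_le [NeZero N] (hN : Odd N) (hβ : 0 ≤ β) (hβ' : β ≤ 1 / 32)
    {f : State N → ℝ} {l η : ℝ} (hl : 0 ≤ l) (hf : ∀ x y, f x - f y ≤ l * pot x y + η)
    (x y : State N) :
    idealOp M₁ M₂ β f x - idealOp M₁ M₂ β f y ≤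
      l * (1 - 1 / (34 * N)) * pot x y + η := by
  have hN' : (0 : ℝ) < N := by exact_mod_cast NeZero.pos N
  set X := x ∘ Sum.inl with hX
  set X' := y ∘ Sum.inl with hX'
  set H := ((hammingDist (x ∘ Sum.inr) (y ∘ Sum.inr) : ℕ) : ℝ) with hH
  have hH0 : 0 ≤ H := Nat.cast_nonneg _
  have hp : pot x y = potX X X' + H := rfl
  have hNp : (N : ℝ) * pot x y = N * potX X X' + N * H := by rw [hp, mul_add]
  have hp0 := pot_nonneg hN x y
  have hpX : 0 ≤ potX X X' := (Nat.cast_nonneg _).trans (hammingDist_le_potX hN X X')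
  -- The sum over all `2 * N` indices must drop by `pot x y / 17`; division by `2 * N` gives the
  -- rate.
  suffices h : ∃ σ c, (∀ i, |(cond M₁ M₂ β (Sum.inr i) x 1).toReal -
      (cond M₁ M₂ β (Sum.inr i) y 1).toReal| ≤ c) ∧
      coupledSum σ X X' + N * H + N * pot x y + (N * c - H) ≤
        2 * N * pot x y - pot x y / 17 by
    obtain ⟨σ, c, hc, h⟩ := h
    have h₁ := sum_inl_sub_le hf x y σ
    have h₂ := sum_inr_sub_le M₁ M₂ β hl hf x y c hc
    have h₃ := mul_le_mul_of_nonneg_left h hl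
    rw [idealOp, idealOp, ← sub_div, div_le_iff₀ (by positivity)]
    have h₄ : (l * (1 - 1 / (34 * N)) * pot x y + η) * (2 * N) =
        l * (2 * N * pot x y - pot x y / 17) + 2 * N * η := by
      field_simp
      ring
    rw [h₄]
    linarith
  have hcrude : ∀ i, |(cond M₁ M₂ β (Sum.inr i) x 1).toReal -
      (cond M₁ M₂ β (Sum.inr i) y 1).toReal| ≤ 1 := fun i => by
    have h₁ := toReal_units_add (cond M₁ M₂ β (Sum.inr i) x) 1
    have h₂ := toReal_units_add (cond M₁ M₂ β (Sum.inr i) y) 1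
    have h₃ := ENNReal.toReal_nonneg (a := cond M₁ M₂ β (Sum.inr i) x 1)
    have h₄ := ENNReal.toReal_nonneg (a := cond M₁ M₂ β (Sum.inr i) y 1)
    have h₅ := ENNReal.toReal_nonneg (a := cond M₁ M₂ β (Sum.inr i) x (-1))
    have h₆ := ENNReal.toReal_nonneg (a := cond M₁ M₂ β (Sum.inr i) y (-1))
    exact abs_le.2 ⟨by linarith, by linarith⟩
  have hpot := pot_le x y
  have unit_of : ∀ X : Fin N → ℤˣ, ¬1 < |magn X| → ∃ e : ℤˣ, magn X = e := fun X h => by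
    have h₁ := one_le_abs_magn hN X
    rcases eq_or_eq_neg_of_abs_eq (le_antisymm (not_lt.1 h) h₁) with h₂ | h₂
    · exact ⟨1, h₂⟩
    · exact ⟨-1, h₂⟩
  -- Outside a common middle layer the second banks may follow different laws, and the trivial `c =
  -- 1` costs `N`. The gain `3 * N` of the first bank leaves `2 * N ≥ pot x y / 17`.
  by_cases hfar : 1 < |magn X| ∨ 1 < |magn X'|
  · refine ⟨Equiv.refl _, 1, hcrude, ?_⟩
    have := coupledSum_refl_le hN hfar
    linarith
  · rw [not_or] at hfar
    obtain ⟨e, he⟩ := unit_of X hfar.1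
    obtain ⟨e', he'⟩ := unit_of X' hfar.2
    rcases units_eq_or e' e with h | h
    · rw [h] at he'
      obtain ⟨σ, hσ⟩ := exists_coupledSum_le he he'
      refine ⟨σ, H / (4 * N), abs_cond_inr_sub_le M₁ M₂ β hβ hβ' (x := x) (y := y) ?_ ?_, ?_⟩
      · rw [sumX_eq_magn, ← hX, he, abs_units]
      · rw [sumX_eq_magn, ← hX', he', abs_units]
      · have : (N : ℝ) * (H / (4 * N)) = H / 4 := by field_simp
        linarith
    · rw [h] at he'
      refine ⟨Equiv.refl _, 1, hcrude, ?_⟩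
      have := coupledSum_refl_le_of_neg he he'
      linarith

/-- One step of sequential Gibbs sampling, as an operator on functions. -/
noncomputable def seqOp [NeZero N] (f : State N → ℝ) (x : State N) : ℝ :=
  expect (staleStep (twoBank N M₁ M₂ β) (twoBank_ne_zero N M₁ M₂ β) x x) f

/-- The samplers differ only where a first-bank spin would align with a nonzero sum of the others,
and `f` has oscillation at most one. This replaces a coupling that would have to control these rare
moves. -/
theorem abs_seqOp_sub_idealOp_le [NeZero N] (hN : Odd N) (hM₂ : 0 ≤ M₂) (hβ : 0 ≤ β)
    {f : State N → ℝ} (hf : ∀ x, 0 ≤ f x ∧ f x ≤ 1) (x : State N) :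
    |seqOp M₁ M₂ β f x - idealOp M₁ M₂ β f x| ≤ Real.exp (M₂ * N ^ 2 - 2 * M₁) := by
  have hN' : (0 : ℝ) < N := by exact_mod_cast NeZero.pos N
  have hcard : (Fintype.card (Var N) : ℝ) = 2 * N := by
    rw [Fintype.card_sum, Fintype.card_fin]
    push_cast
    ring
  have hterm : ∀ i, |(expect (cond M₁ M₂ β (Sum.inl i) x)
        fun z => f (Function.update x (Sum.inl i) z)) -
      (∑ ξ, f (Function.update x (Sum.inl i) (idealValue (x ∘ Sum.inl) i ξ))) / 2| ≤
      Real.exp (M₂ * N ^ 2 - 2 * M₁) := fun i => by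
    have key : ∀ e : ℤˣ, 0 < (e : ℤ) * (sumX x - x (Sum.inl i)) →
        |(expect (cond M₁ M₂ β (Sum.inl i) x) fun z => f (Function.update x (Sum.inl i) z)) -
          f (Function.update x (Sum.inl i) (-e))| ≤ Real.exp (M₂ * N ^ 2 - 2 * M₁) :=
      fun e he => by
        have h₁ := cond_inl_le M₁ M₂ β hN hM₂ hβ he
        have h₂ := toReal_units_add (cond M₁ M₂ β (Sum.inl i) x) e
        have h₀ := ENNReal.toReal_nonneg (a := cond M₁ M₂ β (Sum.inl i) x e)
        have h₃ := hf (Function.update x (Sum.inl i) e)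
        have h₄ := hf (Function.update x (Sum.inl i) (-e))
        rw [expect_units _ _ e]
        have h₅ : (cond M₁ M₂ β (Sum.inl i) x e).toReal * f (Function.update x (Sum.inl i) e) +
            (cond M₁ M₂ β (Sum.inl i) x (-e)).toReal * f (Function.update x (Sum.inl i) (-e)) -
            f (Function.update x (Sum.inl i) (-e)) = (cond M₁ M₂ β (Sum.inl i) x e).toReal *
            (f (Function.update x (Sum.inl i) e) - f (Function.update x (Sum.inl i) (-e))) := by
          linear_combination f (Function.update x (Sum.inl i) (-e)) * h₂
        rw [h₅, abs_mul, abs_of_nonneg h₀]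
        have h₆ : |f (Function.update x (Sum.inl i) e) - f (Function.update x (Sum.inl i) (-e))|
            ≤ 1 := abs_le.2 ⟨by linarith, by linarith⟩
        exact (mul_le_of_le_one_right h₀ h₆).trans h₁
    have hs : magn (x ∘ Sum.inl) - ((x ∘ Sum.inl) i : ℤˣ) = sumX x - x (Sum.inl i) := rfl
    simp only [idealValue, hs]
    split_ifs with h₀ h₁
    · have h := cond_inl_eq_half M₁ M₂ β h₀
      rw [expect, sum_units _ 1, sum_units _ 1, h, h]
      refine (le_of_eq ?_).trans (Real.exp_pos _).le
      rw [abs_eq_zero]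
      ring
    · rw [sum_units _ 1, add_self_div_two]
      exact key 1 (by simpa using h₁)
    · rw [sum_units _ 1, add_self_div_two]
      have := key (-1) (by push_cast; omega)
      rwa [neg_neg] at this
  rw [seqOp, idealOp, expect_staleStep, Fintype.sum_sum_type, hcard, ← sub_div,
    add_sub_add_right_eq_sub, ← Finset.sum_sub_distrib, abs_div,
    abs_of_pos (by positivity : (0 : ℝ) < 2 * N), div_le_iff₀ (by positivity)]
  refine (Finset.abs_sum_le_sum_abs _ _).trans ((Finset.sum_le_sum fun i _ => hterm i).trans ?_)
  rw [Finset.sum_const, Finset.card_univ, Fintype.card_fin, nsmul_eq_mul]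
  have := mul_pos hN' (Real.exp_pos (M₂ * N ^ 2 - 2 * M₁))
  linarith

theorem iterate_seqOp_mem [NeZero N] {f : State N → ℝ} (hf : ∀ x, 0 ≤ f x ∧ f x ≤ 1) (t : ℕ)
    (x : State N) : 0 ≤ (seqOp M₁ M₂ β)^[t] f x ∧ (seqOp M₁ M₂ β)^[t] f x ≤ 1 := by
  induction t generalizing x with
  | zero => exact hf x
  | succ t ih =>
    rw [Function.iterate_succ_apply']
    exact ⟨le_expect _ fun y => (ih y).1, expect_le _ fun y => (ih y).2⟩

theorem iterate_seqOp_sub_le [NeZero N] (hN : Odd N) (hM₂ : 0 ≤ M₂) (hβ : 0 ≤ β)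
    (hβ' : β ≤ 1 / 32) {f : State N → ℝ} (hf : ∀ x, 0 ≤ f x ∧ f x ≤ 1) (t : ℕ) (x y : State N) :
    (seqOp M₁ M₂ β)^[t] f x - (seqOp M₁ M₂ β)^[t] f y ≤
      (1 - 1 / (34 * N)) ^ t * pot x y + 2 * t * Real.exp (M₂ * N ^ 2 - 2 * M₁) := by
  have hN' : (1 : ℝ) ≤ N := by exact_mod_cast NeZero.one_le
  induction t generalizing x y with
  | zero =>
    simp only [Function.iterate_zero, id, pow_zero, Nat.cast_zero]
    -- Distinct states have `pot` at least one, which dominates the oscillation of `f`.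
    rcases eq_or_ne x y with rfl | h
    · linarith [pot_nonneg hN x x]
    · linarith [one_le_pot hN h, (hf x).2, (hf y).1]
  | succ t ih =>
    rw [Function.iterate_succ_apply']
    have hmem := iterate_seqOp_mem M₁ M₂ β hf t
    have h₀ : (0 : ℝ) ≤ 1 - 1 / (34 * N) := by
      rw [sub_nonneg, div_le_one (by positivity)]
      linarith
    have h₁ := idealOp_sub_le M₁ M₂ β hN hβ hβ' (pow_nonneg h₀ t) ih x y
    have h₂ := abs_le.1 (abs_seqOp_sub_idealOp_le M₁ M₂ β hN hM₂ hβ hmem x)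
    have h₃ := abs_le.1 (abs_seqOp_sub_idealOp_le M₁ M₂ β hN hM₂ hβ hmem y)
    rw [pow_succ]
    push_cast
    linarith

theorem tvDist_seqLaw_le [NeZero N] (hN : Odd N) (hM₂ : 0 ≤ M₂) (hβ : 0 ≤ β) (hβ' : β ≤ 1 / 32)
    (t : ℕ) (μ ν : PMF (State N)) :
    tvDist (seqLaw (twoBank N M₁ M₂ β) (twoBank_ne_zero N M₁ M₂ β) t μ)
      (seqLaw (twoBank N M₁ M₂ β) (twoBank_ne_zero N M₁ M₂ β) t ν) ≤
      (1 - 1 / (34 * N)) ^ t * (34 * N) + 2 * t * Real.exp (M₂ * N ^ 2 - 2 * M₁) := by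
  have hN' : (1 : ℝ) ≤ N := by exact_mod_cast NeZero.one_le
  have h₀ : (0 : ℝ) ≤ 1 - 1 / (34 * N) := by
    rw [sub_nonneg, div_le_one (by positivity)]
    linarith
  refine ciSup_le fun A => ?_
  have hA : ∀ x : State N, (0 : ℝ) ≤ A.indicator 1 x ∧ (A.indicator 1 x : ℝ) ≤ 1 := fun x => by
    by_cases hx : x ∈ A <;> simp [hx]
  have hosc : ∀ x y, (seqOp M₁ M₂ β)^[t] (A.indicator 1) x -
      (seqOp M₁ M₂ β)^[t] (A.indicator 1) y ≤
      (1 - 1 / (34 * N)) ^ t * (34 * N) + 2 * t * Real.exp (M₂ * N ^ 2 - 2 * M₁) := fun x y => by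
    have h₁ := iterate_seqOp_sub_le M₁ M₂ β hN hM₂ hβ hβ' hA t x y
    have h₂ := mul_le_mul_of_nonneg_left (pot_le x y) (pow_nonneg h₀ t)
    linarith
  rw [toReal_toOuterMeasure, toReal_toOuterMeasure, expect_seqLaw, expect_seqLaw]
  exact abs_sub_le_iff.2 ⟨expect_sub_expect_le μ ν hosc, expect_sub_expect_le ν μ hosc⟩

end Contraction

/-- With a strong restoring force and weak coupling, sequential Gibbs sampling mixes in
`O(N log N)` steps. -/
theorem seqMixingTime_le {ε : ℝ} (hε : 0 < ε) :
    ∃ C : ℝ, 0 < C ∧ ∃ N₀ : ℕ, ∀ (N : ℕ) [NeZero N], Odd N → N₀ ≤ N →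
      (seqMixingTime N ((N : ℝ) ^ 2 + 1) 1 (1 / 32) ε : ℝ≥0∞) ≤
        ENNReal.ofReal (C * (N * Real.log N)) := by
  refine ⟨69, by norm_num, max 3 ⌈880 / ε⌉₊, fun N _ hN hN₀ => ?_⟩
  have hN3 : (3 : ℝ) ≤ N := by exact_mod_cast (le_max_left _ _).trans hN₀
  have hNε : 880 / ε ≤ N := (Nat.le_ceil _).trans (by exact_mod_cast (le_max_right _ _).trans hN₀)
  have hpos : (0 : ℝ) < N := by linarith
  have hlog : 1 ≤ Real.log N := by
    rw [Real.le_log_iff_exp_le hpos]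
    linarith [Real.exp_one_lt_d9]
  have hlog' : Real.log N ≤ N := (Real.log_le_sub_one_of_pos hpos).trans (by linarith)
  have hNlog : 1 ≤ N * Real.log N := by nlinarith
  -- With `68 = 2 * 34` the contraction factor is at most `1 / N ^ 2`, which beats `pot ≤ 34 * N`.
  -- The constant `69` absorbs the rounding, and `880` exceeds `34 + 828` from the two error terms.
  set t := ⌈68 * (N * Real.log N)⌉₊ with ht
  have ht₁ : 68 * (N * Real.log N) ≤ t := Nat.le_ceil _
  have ht₂ : (t : ℝ) ≤ 69 * (N * Real.log N) :=
    (Nat.ceil_lt_add_one (by positivity)).le.trans (by linarith)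
  have htN : (t : ℝ) ≤ 69 * N ^ 2 := ht₂.trans (by nlinarith)
  have hmix : seqMixingTime N ((N : ℝ) ^ 2 + 1) 1 (1 / 32) ε ≤ t := by
    refine mixingTime_le fun μ₀ => (tvDist_seqLaw_le _ _ _ hN zero_le_one (by norm_num) le_rfl
      t μ₀ _).trans ?_
    have h₁ : (1 - 1 / (34 * N : ℝ)) ^ t * (34 * N) ≤ 34 / N := by
      have h₂ : (1 - 1 / (34 * N : ℝ)) ^ t ≤ Real.exp (-(2 * Real.log N)) := by
        calc (1 - 1 / (34 * N : ℝ)) ^ t ≤ Real.exp (-(1 / (34 * N))) ^ t := by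
              refine pow_le_pow_left₀ ?_ (Real.one_sub_le_exp_neg _) t
              rw [sub_nonneg, div_le_one (by positivity)]
              linarith
          _ = Real.exp (t * -(1 / (34 * N))) := (Real.exp_nat_mul _ _).symm
          _ ≤ _ := by
              refine Real.exp_le_exp.2 ?_
              rw [mul_neg, neg_le_neg_iff, mul_one_div, le_div_iff₀ (by positivity)]
              linarith
      have h₃ : Real.exp (-(2 * Real.log N)) = 1 / (N : ℝ) ^ 2 := by
        rw [Real.exp_neg, two_mul, Real.exp_add, Real.exp_log hpos, sq, one_div]
      calc _ ≤ 1 / (N : ℝ) ^ 2 * (34 * N) := by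
            rw [← h₃]
            gcongr
        _ = 34 / N := by field_simp
    have h₄ : 2 * t * Real.exp (1 * (N : ℝ) ^ 2 - 2 * ((N : ℝ) ^ 2 + 1)) ≤ 828 / N := by
      have h₅ : Real.exp (1 * (N : ℝ) ^ 2 - 2 * ((N : ℝ) ^ 2 + 1)) ≤ 6 / (N : ℝ) ^ 3 := by
        calc _ ≤ Real.exp (-N) := Real.exp_le_exp.2 (by nlinarith)
          _ ≤ _ := by
            have := Real.pow_div_factorial_le_exp (N : ℝ) hpos.le 3
            rw [Real.exp_neg, inv_le_comm₀ (Real.exp_pos _) (by positivity), inv_div]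
            simpa [Nat.factorial] using this
      calc _ ≤ 2 * (69 * (N : ℝ) ^ 2) * (6 / (N : ℝ) ^ 3) := by gcongr
        _ = 828 / N := by field_simp; norm_num
    have h₆ : 880 / N ≤ ε := by
      rw [div_le_iff₀ hε] at hNε
      rw [div_le_iff₀ hpos]
      linarith
    have h₇ : 34 / (N : ℝ) + 828 / N ≤ 880 / N := by
      rw [← add_div]
      gcongr
      norm_num
    linarith
  calc (seqMixingTime N ((N : ℝ) ^ 2 + 1) 1 (1 / 32) ε : ℝ≥0∞)
      ≤ ((t : ℕ∞) : ℝ≥0∞) := ENat.toENNReal_le.2 hmix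
    _ = ENNReal.ofReal t := by simp
    _ ≤ _ := ENNReal.ofReal_le_ofReal ht₂

/-! ### A delay model that makes the first bank look unbalanced -/

section Delays

variable {N : ℕ}

/-- The variables of the first bank chosen by `U` are read with delay `2`, all others without. -/
def delayVec (U : Fin N → Bool) : Var N → ℕ := Sum.elim (fun i => if U i then 2 else 0) fun _ => 0

theorem delayVec_le (U : Fin N → Bool) (i : Var N) : delayVec U i ≤ 2 := by
  rcases i with i | i
  · simp only [delayVec, Sum.elim_inl]
    split_ifs <;> norm_num
  · exact Nat.zero_le 2

/-- No delays, except that at every third time the variables of the first bank are independently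
read with delay `0` or `2`. -/
noncomputable def tripleDelay (N : ℕ) : DelayModel (Var N) ℤˣ where
  law h := if h.time % 3 = 2 then (PMF.uniformOfFintype (Fin N → Bool)).map delayVec
    else PMF.pure 0
  le_time h d hd i := by
    split_ifs at hd with ht
    · obtain ⟨U, -, rfl⟩ := (PMF.mem_support_map_iff _ _ _).1 hd
      have := delayVec_le U i
      omega
    · rw [(PMF.mem_support_pure_iff _ _).1 hd]
      exact Nat.zero_le _

theorem tripleDelay_le_two (h : History (Var N) ℤˣ) (d : Var N → ℕ)
    (hd : (tripleDelay N).law h d ≠ 0) (i : Var N) : d i ≤ 2 := by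
  rw [← PMF.mem_support_iff] at hd
  simp only [tripleDelay] at hd
  split_ifs at hd with ht
  · obtain ⟨U, -, rfl⟩ := (PMF.mem_support_map_iff _ _ _).1 hd
    exact delayVec_le U i
  · rw [(PMF.mem_support_pure_iff _ _).1 hd]
    exact Nat.zero_le _

theorem tsum_tripleDelay_mul_le (h : History (Var N) ℤˣ) {f : (Var N → ℕ) → ℝ≥0∞} {c : ℝ≥0∞}
    (hf : ∀ d, (∀ i, d i ≤ 2) → f d ≤ c) : ∑' d, (tripleDelay N).law h d * f d ≤ c :=
  calc ∑' d, (tripleDelay N).law h d * f d ≤ ∑' d, (tripleDelay N).law h d * c := by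
        refine ENNReal.tsum_le_tsum fun d => ?_
        rcases eq_or_ne ((tripleDelay N).law h d) 0 with h₀ | h₀
        · simp [h₀]
        · exact mul_le_mul_right (hf d (tripleDelay_le_two h d h₀)) _
    _ = c := by rw [ENNReal.tsum_mul_right, PMF.tsum_coe, one_mul]

theorem tripleDelay_expectedDelayLE (N : ℕ) : (tripleDelay N).ExpectedDelayLE 2 := fun h i =>
  tsum_tripleDelay_mul_le h fun d hd => by exact_mod_cast hd i

theorem tripleDelay_expDelayLE (N : ℕ) : (tripleDelay N).ExpDelayLE 16 := fun h i => by
  refine tsum_tripleDelay_mul_le h fun d hd => ?_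
  have hcard : 0 < Fintype.card (Var N) := Fintype.card_pos_iff.2 ⟨i⟩
  generalize Fintype.card (Var N) = n at *
  have hn : (1 : ℝ) ≤ n := by exact_mod_cast hcard
  have h₁ : Real.exp ((d i : ℝ) / n) ≤ 1 + 16 / n := by
    have h₂ : (d i : ℝ) / n ≤ 2 / n := by
      gcongr
      exact_mod_cast hd i
    have h₃ : (2 : ℝ) / n ≤ 2 := by
      rw [div_le_iff₀ (by positivity)]
      linarith
    have h₄ : Real.exp 2 ≤ 8 := by
      have := Real.exp_one_lt_d9
      have h₅ : Real.exp 2 = Real.exp 1 * Real.exp 1 := by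
        rw [← Real.exp_add]
        norm_num
      rw [h₅]
      nlinarith [Real.exp_pos 1]
    have h₆ : Real.exp (2 / n) ≤ 8 := (Real.exp_le_exp.2 h₃).trans h₄
    -- Multiplying `1 - u ≤ exp (-u)` by `exp u` gives `exp u ≤ 1 + u * exp u`, here with `u = 2 /
    -- n` and `exp u ≤ 8`.
    have h₇ := Real.one_sub_le_exp_neg (2 / n : ℝ)
    have h₈ : Real.exp (2 / n) * Real.exp (-(2 / n)) = 1 := by
      rw [← Real.exp_add, add_neg_cancel, Real.exp_zero]
    have h₉ : (0 : ℝ) ≤ 2 / n := by positivity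
    have h₀ : Real.exp (2 / n) ≤ 1 + 8 * (2 / n) := by
      nlinarith [Real.exp_pos (2 / n : ℝ)]
    calc _ ≤ Real.exp (2 / n) := Real.exp_le_exp.2 h₂
      _ ≤ 1 + 8 * (2 / n) := h₀
      _ = _ := by ring
  calc _ ≤ ENNReal.ofReal (1 + 16 / n) := ENNReal.ofReal_le_ofReal h₁
    _ = _ := by
      rw [ENNReal.ofReal_add zero_le_one (by positivity), ENNReal.ofReal_one,
        ENNReal.ofReal_div_of_pos (by positivity), ENNReal.ofReal_natCast]
      norm_num

theorem tripleDelay_oblivious (N : ℕ) : (tripleDelay N).Oblivious := fun h h' ht => by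
  simp only [tripleDelay, ht]

/-- The view that takes the variables of the first bank chosen by `U` from `x`, and all the others
from `y`. -/
def mixView (U : Fin N → Bool) (x y : State N) : State N :=
  Sum.elim (fun i => if U i then x (Sum.inl i) else y (Sum.inl i)) fun i => y (Sum.inr i)

/-- Delay two reaches exactly the state at the start of the block, so the third write needs no
earlier history and blocks form a Markov chain on states. -/
theorem stale_push_push (h : History (Var N) ℤˣ) (i j : Var N) (z w : ℤˣ) (U : Fin N → Bool) :
    ((h.push 0 i z).push 0 j w).stale (delayVec U) =
      mixView U h.current ((h.push 0 i z).push 0 j w).current := by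
  funext k
  rcases k with k | k
  · simp only [History.stale, delayVec, mixView, Sum.elim_inl]
    split_ifs <;> rfl
  · rfl

end Delays

/-! ### Three writes form a step of a Markov chain -/

section Block

variable {N : ℕ} [NeZero N] (π : PMF (State N)) (hπ : ∀ x, π x ≠ 0)

/-- The law of the state three writes after a time at which it was `x`. -/
noncomputable def blockStep (x : State N) : PMF (State N) :=
  (staleStep π hπ x x).bind fun x₁ => (staleStep π hπ x₁ x₁).bind fun x₂ =>
    (PMF.uniformOfFintype (Fin N → Bool)).bind fun U => staleStep π hπ (mixView U x x₂) x₂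

theorem hogStep_bind {h : History (Var N) ℤˣ} (ht : h.time % 3 ≠ 2) {γ : Type*}
    {F : History (Var N) ℤˣ → PMF γ} {G : State N → PMF γ}
    (hFG : ∀ i z, F (h.push 0 i z) = G (Function.update h.current i z)) :
    (hogStep π hπ (tripleDelay N) h).bind F = (staleStep π hπ h.current h.current).bind G := by
  have hs : h.stale 0 = h.current := rfl
  simp only [hogStep, tripleDelay, if_neg ht, PMF.pure_bind, staleStep, PMF.bind_bind,
    PMF.bind_map, hs]
  congr 1
  funext i
  congr 1
  funext z
  exact hFG i z

theorem hogStep_map_current {h : History (Var N) ℤˣ} (ht : h.time % 3 = 2) :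
    (hogStep π hπ (tripleDelay N) h).map History.current =
      (PMF.uniformOfFintype (Fin N → Bool)).bind fun U =>
        staleStep π hπ (h.stale (delayVec U)) h.current := by
  simp only [hogStep, tripleDelay, if_pos ht, PMF.map_bind, PMF.bind_map, PMF.map_comp,
    Function.comp_apply, staleStep]
  rfl

theorem hogStep_hogStep_hogStep {h : History (Var N) ℤˣ} (ht : h.time % 3 = 0) :
    ((hogStep π hπ (tripleDelay N) h).bind fun h₁ => (hogStep π hπ (tripleDelay N) h₁).bind
      fun h₂ => (hogStep π hπ (tripleDelay N) h₂).map History.current) =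
      blockStep π hπ h.current := by
  have time_push : ∀ (h : History (Var N) ℤˣ) d i z, (h.push d i z).time = h.time + 1 :=
    fun _ _ _ _ => rfl
  refine hogStep_bind π hπ (by omega) fun i z => hogStep_bind π hπ
    (by rw [time_push]; omega) fun j w => ?_
  rw [hogStep_map_current π hπ (by rw [time_push, time_push]; omega)]
  simp only [stale_push_push]
  rfl

/-- The law of the history after `t` writes. -/
noncomputable def histLaw (t : ℕ) (μ : PMF (State N)) : PMF (History (Var N) ℤˣ) :=
  (fun μ => μ.bind (hogStep π hπ (tripleDelay N)))^[t] (μ.map fun x => ⟨x, []⟩)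

theorem histLaw_succ (t : ℕ) (μ : PMF (State N)) :
    histLaw π hπ (t + 1) μ = (histLaw π hπ t μ).bind (hogStep π hπ (tripleDelay N)) :=
  Function.iterate_succ_apply' _ _ _

theorem hogLaw_eq_map (t : ℕ) (μ : PMF (State N)) :
    hogLaw π hπ (tripleDelay N) t μ = (histLaw π hπ t μ).map History.current := rfl

theorem time_of_mem_support (t : ℕ) (μ : PMF (State N)) {h : History (Var N) ℤˣ}
    (hh : h ∈ (histLaw π hπ t μ).support) : h.time = t := by
  induction t generalizing h with
  | zero =>
    obtain ⟨x, -, rfl⟩ := (PMF.mem_support_map_iff _ _ _).1 hh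
    rfl
  | succ t ih =>
    rw [histLaw_succ, PMF.mem_support_bind_iff] at hh
    obtain ⟨h₀, hh₀, hh⟩ := hh
    simp only [hogStep, PMF.mem_support_bind_iff, PMF.mem_support_map_iff] at hh
    obtain ⟨d, -, i, -, z, -, rfl⟩ := hh
    exact congrArg (· + 1) (ih hh₀)

theorem bind_congr_support {α γ : Type*} (p : PMF α) {f g : α → PMF γ}
    (h : ∀ a ∈ p.support, f a = g a) : p.bind f = p.bind g := by
  ext c
  rw [PMF.bind_apply, PMF.bind_apply]
  refine tsum_congr fun a => ?_
  rcases eq_or_ne (p a) 0 with ha | ha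
  · rw [ha, zero_mul, zero_mul]
  · rw [h a ((PMF.mem_support_iff _ _).2 ha)]

theorem hogLaw_succ {t : ℕ} (ht : t % 3 ≠ 2) (μ : PMF (State N)) :
    hogLaw π hπ (tripleDelay N) (t + 1) μ =
      (hogLaw π hπ (tripleDelay N) t μ).bind fun x => staleStep π hπ x x := by
  rw [hogLaw_eq_map, hogLaw_eq_map, histLaw_succ, PMF.map_bind, PMF.bind_map]
  refine bind_congr_support _ fun h hh => ?_
  have ht' : h.time % 3 ≠ 2 := by rwa [time_of_mem_support π hπ t μ hh]
  rw [← PMF.bind_pure_comp]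
  exact (hogStep_bind π hπ ht' (G := PMF.pure) fun i z => rfl).trans (PMF.bind_pure _)

theorem hogLaw_add_three {t : ℕ} (ht : t % 3 = 0) (μ : PMF (State N)) :
    hogLaw π hπ (tripleDelay N) (t + 3) μ =
      (hogLaw π hπ (tripleDelay N) t μ).bind (blockStep π hπ) := by
  rw [hogLaw_eq_map, hogLaw_eq_map, histLaw_succ, histLaw_succ, histLaw_succ, PMF.map_bind,
    PMF.bind_bind, PMF.bind_bind, PMF.bind_map]
  refine bind_congr_support _ fun h hh => ?_
  have ht' : h.time % 3 = 0 := by rwa [time_of_mem_support π hπ t μ hh]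
  exact hogStep_hogStep_hogStep π hπ ht'

end Block

/-! ### How often the third write of a block sees an unbalanced first bank -/

section LowerBound

variable {N : ℕ}

theorem card_var (N : ℕ) : (Fintype.card (Var N) : ℝ) = 2 * N := by
  rw [Fintype.card_sum, Fintype.card_fin]
  push_cast
  ring

theorem expect_staleStep_mono [NeZero N] {π : PMF (State N)} {hπ : ∀ x, π x ≠ 0} {v x : State N}
    {f g : State N → ℝ} (h : ∀ i z, f (Function.update x i z) ≤ g (Function.update x i z)) :
    expect (staleStep π hπ v x) f ≤ expect (staleStep π hπ v x) g := by
  rw [expect_staleStep, expect_staleStep]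
  gcongr with i
  exact expect_mono _ fun z => h i z

theorem le_expect_staleStep [NeZero N] {π : PMF (State N)} {hπ : ∀ x, π x ≠ 0} {v x : State N}
    {f : State N → ℝ} (hf : ∀ y, 0 ≤ f y) (I : Finset (Var N)) {a : ℝ}
    (h : ∀ i ∈ I, a ≤ expect (conditional π hπ i v) fun z => f (Function.update x i z)) :
    I.card * a / (2 * N) ≤ expect (staleStep π hπ v x) f := by
  rw [expect_staleStep, card_var]
  gcongr
  calc (I.card : ℝ) * a = ∑ _i ∈ I, a := by rw [Finset.sum_const, nsmul_eq_mul]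
    _ ≤ ∑ i ∈ I, expect (conditional π hπ i v) fun z => f (Function.update x i z) :=
        Finset.sum_le_sum h
    _ ≤ _ := Finset.sum_le_univ_sum_of_nonneg fun i => le_expect _ fun z => hf _

/-- One if the magnetization of the first bank is not `±1`, and zero otherwise. -/
noncomputable def unbalanced (v : State N) : ℝ := if |sumX v| = 1 then 0 else 1

theorem unbalanced_nonneg (v : State N) : 0 ≤ unbalanced v := by
  unfold unbalanced
  positivity

/-- The probability that the view of the last write of a block is unbalanced, if the state was `x`
before the first and `y` after the second one. -/
noncomputable def viewProb (x y : State N) : ℝ :=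
  expect (PMF.uniformOfFintype (Fin N → Bool)) fun U => unbalanced (mixView U x y)

theorem viewProb_nonneg (x y : State N) : 0 ≤ viewProb x y :=
  le_expect _ fun _ => unbalanced_nonneg _

theorem quarter_le_expect_bits {i j : Fin N} (hij : i ≠ j) {f : (Fin N → Bool) → ℝ}
    (hf : ∀ U, 0 ≤ f U) (h : ∀ U, U i = true → U j = false → 1 ≤ f U) :
    1 / 4 ≤ expect (PMF.uniformOfFintype (Fin N → Bool)) f := by
  -- Flipping the bits `i` and `j` preserves the uniform law, and each orbit of four contains a
  -- vector with `U i = true` and `U j = false`.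
  have flip : ∀ (k : Fin N) (F : (Fin N → Bool) → ℝ),
      ∑ U, F (Function.update U k (!U k)) = ∑ U, F U := fun k F => by
    have hinv : Function.Involutive fun U : Fin N → Bool => Function.update U k (!U k) :=
      fun U => by simp
    exact Equiv.sum_comp hinv.toPerm F
  set F : (Fin N → Bool) → ℝ := fun U => f U + f (Function.update U i (!U i)) with hF
  have h₁ : ∑ U, F U = 2 * ∑ U, f U := by
    rw [hF, Finset.sum_add_distrib, flip i f]
    ring
  have h₂ : ∑ U, (F U + F (Function.update U j (!U j))) = 4 * ∑ U, f U := by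
    rw [Finset.sum_add_distrib, flip j F, h₁]
    ring
  have h₃ : ∀ U, 1 ≤ F U + F (Function.update U j (!U j)) := fun U => by
    have key : ∀ W : Fin N → Bool, W j = false → 1 ≤ F W := fun W hW => by
      cases hi : W i
      · have := h (Function.update W i (!W i)) (by simp [hi])
          (by rw [Function.update_of_ne hij.symm, hW])
        linarith [hf W]
      · linarith [h W hi hW, hf (Function.update W i (!W i))]
    have hF0 : ∀ W, 0 ≤ F W := fun W => add_nonneg (hf _) (hf _)
    cases hj : U j
    · linarith [key U hj, hF0 (Function.update U j (!false))]
    · have := key (Function.update U j (!U j)) (by simp [hj])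
      rw [hj] at this
      linarith [hF0 U]
  have h₄ : (Fintype.card (Fin N → Bool) : ℝ) ≤ 4 * ∑ U, f U := by
    rw [← h₂]
    calc (Fintype.card (Fin N → Bool) : ℝ) = ∑ _U : Fin N → Bool, 1 := by simp
      _ ≤ _ := Finset.sum_le_sum fun U _ => h₃ U
  have h₅ : (0 : ℝ) < Fintype.card (Fin N → Bool) := by exact_mod_cast Fintype.card_pos
  rw [expect_uniform, le_div_iff₀ h₅]
  linarith

variable (M₁ M₂ β : ℝ)

/-- The Gibbs write in the two-bank model, with view `v`. -/
noncomputable abbrev bankStep [NeZero N] (v x : State N) : PMF (State N) :=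
  staleStep (twoBank N M₁ M₂ β) (twoBank_ne_zero N M₁ M₂ β) v x

theorem viewProb_eq_one {x y : State N} (h : y ∘ Sum.inl = x ∘ Sum.inl) (hx : |sumX x| ≠ 1) :
    viewProb x y = 1 := by
  have h₁ : ∀ U, unbalanced (mixView U x y) = 1 := fun U => by
    have : sumX (mixView U x y) = sumX x := by
      rw [sumX_eq_magn, sumX_eq_magn]
      congr 1
      funext i
      have := congrFun h i
      simp only [Function.comp_apply] at this
      simp [mixView, this]
    rw [unbalanced, this, if_neg hx]
  rw [viewProb]
  simp only [h₁, expect_const]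

/-- A view with the old value `e` at `i` and the new value `e` at `j` sees neither spin as `-e`. All
other sites agree in both states, so its magnetization is `3 * e`. -/
theorem quarter_le_viewProb {x : State N} {e : ℤˣ} (hx : sumX x = e) {i j : Fin N}
    (hij : i ≠ j) (hj : x (Sum.inl j) = -e) :
    1 / 4 ≤ viewProb x
      (Function.update (Function.update x (Sum.inl i) (-e)) (Sum.inl j) e) := by
  refine quarter_le_expect_bits hij (fun U => unbalanced_nonneg _) fun U hi hj' => ?_
  have h : mixView U x (Function.update (Function.update x (Sum.inl i) (-e)) (Sum.inl j) e) ∘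
      Sum.inl = Function.update (x ∘ Sum.inl) j e := by
    funext k
    simp only [mixView, Function.comp_apply, Sum.elim_inl]
    rcases eq_or_ne k j with rfl | hkj
    · simp [hj']
    · rcases eq_or_ne k i with rfl | hki
      · simp [hi, hkj]
      · simp [hkj, hki]
  have hs : sumX (mixView U x
      (Function.update (Function.update x (Sum.inl i) (-e)) (Sum.inl j) e)) = 3 * e := by
    rw [sumX_eq_magn, h, magn_update, ← sumX_eq_magn, hx, Function.comp_apply, hj, Units.val_neg]
    ring
  rw [unbalanced, hs, abs_mul, abs_units]
  norm_num

/-- With probability `1 / 4` both writes hit the second bank. Then old and new first bank coincide,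
and every view of them is as unbalanced as `x`. -/
theorem le_expect_viewProb_of_ne [NeZero N] {x : State N} (hx : |sumX x| ≠ 1) :
    1 / 4 ≤ expect (bankStep M₁ M₂ β x x) fun x₁ =>
      expect (bankStep M₁ M₂ β x₁ x₁) (viewProb x) := by
  have hN : (0 : ℝ) < N := by exact_mod_cast NeZero.pos N
  have hcard : (Finset.univ.map (Function.Embedding.inr : Fin N ↪ Var N)).card = N := by simp
  have h₂ : ∀ x₁ : State N, x₁ ∘ Sum.inl = x ∘ Sum.inl →
      1 / 2 ≤ expect (bankStep M₁ M₂ β x₁ x₁) (viewProb x) := fun x₁ hx₁ => by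
    refine le_trans (le_of_eq ?_) (le_expect_staleStep (viewProb_nonneg x)
      (Finset.univ.map (Function.Embedding.inr : Fin N ↪ Var N)) (a := 1) ?_)
    · rw [hcard]
      field_simp
    · intro i hi
      obtain ⟨k, -, rfl⟩ := Finset.mem_map.1 hi
      refine le_expect _ fun z => (viewProb_eq_one ?_ hx).ge
      exact (Sum.update_inr_comp_inl).trans hx₁
  refine le_trans (le_of_eq ?_) (le_expect_staleStep
    (fun y => le_expect _ fun _ => viewProb_nonneg x _)
    (Finset.univ.map (Function.Embedding.inr : Fin N ↪ Var N)) (a := 1 / 2) ?_)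
  · rw [hcard]
    field_simp
    norm_num
  · intro i hi
    obtain ⟨k, -, rfl⟩ := Finset.mem_map.1 hi
    exact le_expect _ fun z => h₂ _ Sum.update_inr_comp_inl

theorem half_mul_le_expect_cond {v : State N} {i : Fin N}
    (hs : sumX v - v (Sum.inl i) = 0) {f : ℤˣ → ℝ} (hf : ∀ z, 0 ≤ f z) (z : ℤˣ) :
    1 / 2 * f z ≤ expect (cond M₁ M₂ β (Sum.inl i) v) f := by
  rw [expect_units _ _ z, cond_inl_eq_half M₁ M₂ β hs]
  exact le_add_of_nonneg_right (mul_nonneg ENNReal.toReal_nonneg (hf _))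

/-- The constant is `(1 / 4) (1 / 2) (1 / 6) (1 / 2) (1 / 4)`: choose a majority site, flip it by a
fair coin, choose one of the original minority sites (`(N - 1) / (4 N) ≥ 1 / 6` for `N ≥ 3`), flip
it by a fair coin, and read the two inconsistently. -/
theorem le_expect_viewProb_of_eq [NeZero N] (hN : 3 ≤ N) {x : State N} {e : ℤˣ} (hx : sumX x = e) :
    1 / 384 ≤ expect (bankStep M₁ M₂ β x x) fun x₁ =>
      expect (bankStep M₁ M₂ β x₁ x₁) (viewProb x) := by
  have hN' : (3 : ℝ) ≤ N := by exact_mod_cast hN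
  have hpos : (0 : ℝ) < N := by linarith
  set A := Finset.univ.filter fun i : Fin N => x (Sum.inl i) = e with hA
  set B := Finset.univ.filter fun i : Fin N => x (Sum.inl i) ≠ e with hB
  have hBcard : 2 * (B.card : ℝ) = N - 1 := by
    have := mul_magn (x ∘ Sum.inl) e
    rw [← sumX_eq_magn, hx, ← Units.val_mul, Int.units_mul_self, Units.val_one,
      ← Int.cast_inj (α := ℝ)] at this
    push_cast at this
    simp only [Function.comp_apply, ← hB] at this
    linarith
  have hAcard : 2 * (A.card : ℝ) = N + 1 := by
    have := Finset.card_filter_add_card_filter_not (s := Finset.univ)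
      (fun i : Fin N => x (Sum.inl i) = e)
    rw [Finset.card_univ, Fintype.card_fin] at this
    have h₁ : (A.card : ℝ) + B.card = N := by exact_mod_cast this
    linarith
  have h₂ : ∀ i ∈ A, 1 / 48 ≤ expect (bankStep M₁ M₂ β
      (Function.update x (Sum.inl i) (-e)) (Function.update x (Sum.inl i) (-e))) (viewProb x) :=
    fun i hi => by
      rw [hA, Finset.mem_filter] at hi
      have hs : sumX (Function.update x (Sum.inl i) (-e)) = -e := by
        rw [sumX_update_inl, hx, hi.2, Units.val_neg]
        ring
      refine le_trans ?_ (le_expect_staleStep (viewProb_nonneg x)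
        (B.map (Function.Embedding.inl : Fin N ↪ Var N)) (a := 1 / 8) ?_)
      · rw [Finset.card_map, le_div_iff₀ (by positivity)]
        linarith
      · intro k hk
        obtain ⟨j, hj, rfl⟩ := Finset.mem_map.1 hk
        rw [hB, Finset.mem_filter] at hj
        have hij : i ≠ j := fun h => hj.2 (h ▸ hi.2)
        have hje := units_ne_iff.1 hj.2
        have h₃ := quarter_le_viewProb hx hij hje
        have h₄ := half_mul_le_expect_cond M₁ M₂ β
          (v := Function.update x (Sum.inl i) (-e)) (i := j)
          (by rw [hs, Function.update_of_ne (by simpa using hij.symm), hje, Units.val_neg,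
            sub_self])
          (fun z => viewProb_nonneg x
            (Function.update (Function.update x (Sum.inl i) (-e)) (Sum.inl j) z)) e
        refine le_trans ?_ h₄
        linarith
  refine le_trans ?_ (le_expect_staleStep
    (fun y => le_expect _ fun _ => viewProb_nonneg x _)
    (A.map (Function.Embedding.inl : Fin N ↪ Var N)) (a := 1 / 96) ?_)
  · rw [Finset.card_map, le_div_iff₀ (by positivity)]
    linarith
  · intro k hk
    obtain ⟨i, hi, rfl⟩ := Finset.mem_map.1 hk
    have h₃ := h₂ i hi
    rw [hA, Finset.mem_filter] at hi
    have h₄ := half_mul_le_expect_cond M₁ M₂ β (v := x) (i := i) (by rw [hx, hi.2, sub_self])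
      (f := fun z => expect (bankStep M₁ M₂ β (Function.update x (Sum.inl i) z)
        (Function.update x (Sum.inl i) z)) (viewProb x))
      (fun z => le_expect _ fun _ => viewProb_nonneg x _) (-e)
    refine le_trans ?_ h₄
    linarith

theorem le_expect_viewProb [NeZero N] (hN : 3 ≤ N) (x : State N) :
    1 / 384 ≤ expect (bankStep M₁ M₂ β x x) fun x₁ =>
      expect (bankStep M₁ M₂ β x₁ x₁) (viewProb x) := by
  by_cases hx : |sumX x| = 1
  · rcases eq_or_eq_neg_of_abs_eq hx with h | h
    · exact le_expect_viewProb_of_eq M₁ M₂ β hN (e := 1) h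
    · exact le_expect_viewProb_of_eq M₁ M₂ β hN (e := -1) h
  · exact le_trans (by norm_num) (le_expect_viewProb_of_ne M₁ M₂ β hx)

end LowerBound

/-! ### Drift of the second bank -/

section Drift

variable {N : ℕ}

/-- The number of variables of the second bank that differ from `e`. -/
def minority (e : ℤˣ) (x : State N) : ℕ := (Finset.univ.filter fun i => x (Sum.inr i) ≠ e).card

theorem mul_sumY (e : ℤˣ) (x : State N) : (e : ℤ) * sumY x = N - 2 * minority e x :=
  mul_magn (x ∘ Sum.inr) e

theorem minority_update_inl (e : ℤˣ) (x : State N) (i : Fin N) (z : ℤˣ) :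
    minority e (Function.update x (Sum.inl i) z) = minority e x := by
  simp [minority]

theorem minority_update_inr_add (e : ℤˣ) (x : State N) (i : Fin N) (z : ℤˣ) :
    minority e (Function.update x (Sum.inr i) z) + (if x (Sum.inr i) ≠ e then 1 else 0) =
      minority e x + if z ≠ e then 1 else 0 := by
  have h₁ := mul_sumY e x
  have h₂ := mul_sumY e (Function.update x (Sum.inr i) z)
  rw [sumY_update_inr, mul_add, mul_sub, h₁] at h₂
  have h₃ : ∀ a : ℤˣ, (e : ℤ) * a = 1 - 2 * if a ≠ e then 1 else 0 := by
    clear * -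
    revert e
    decide
  rw [h₃, h₃] at h₂
  split_ifs at * <;> omega

theorem minority_update_le (e : ℤˣ) (x : State N) (i : Var N) (z : ℤˣ) :
    minority e (Function.update x i z) ≤ minority e x + 1 ∧
      minority e x ≤ minority e (Function.update x i z) + 1 := by
  rcases i with i | i
  · rw [minority_update_inl]
    omega
  · have := minority_update_inr_add e x i z
    split_ifs at this <;> omega

/-- The exponential potential. -/
noncomputable def expPot (θ : ℝ) (e : ℤˣ) (x : State N) : ℝ := Real.exp (θ * minority e x)

theorem expPot_pos (θ : ℝ) (e : ℤˣ) (x : State N) : 0 < expPot θ e x := Real.exp_pos _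

theorem expPot_update_le {θ : ℝ} (hθ : 0 ≤ θ) (e : ℤˣ) (x : State N) (i : Var N) (z : ℤˣ) :
    expPot θ e (Function.update x i z) ≤ Real.exp θ * expPot θ e x ∧
      expPot θ e x ≤ Real.exp θ * expPot θ e (Function.update x i z) := by
  have h := minority_update_le e x i z
  have h₁ : (minority e (Function.update x i z) : ℝ) ≤ minority e x + 1 := by exact_mod_cast h.1
  have h₂ : (minority e x : ℝ) ≤ minority e (Function.update x i z) + 1 := by exact_mod_cast h.2
  unfold expPot
  rw [← Real.exp_add, ← Real.exp_add]
  exact ⟨Real.exp_le_exp.2 (by nlinarith), Real.exp_le_exp.2 (by nlinarith)⟩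

variable (M₁ M₂ β : ℝ)

/-- The change of the potential in one write, in terms of a bound on the probability that a
variable of the second bank is set to `-e`. -/
theorem expect_expPot_le [NeZero N] {θ p : ℝ} (hθ : 0 ≤ θ) {e : ℤˣ} {v x : State N}
    (hp : ∀ i, (cond M₁ M₂ β (Sum.inr i) v (-e)).toReal ≤ p) :
    expect (bankStep M₁ M₂ β v x) (expPot θ e) ≤ expPot θ e x *
      (1 + ((1 - minority e x / N) * p * (Real.exp θ - 1) -
        minority e x / N * (1 - p) * (1 - Real.exp (-θ))) / 2) := by
  have hN : (0 : ℝ) < N := by exact_mod_cast NeZero.pos N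
  have hV := expPot_pos θ e x
  have hu : 0 ≤ Real.exp θ - 1 := by linarith [Real.add_one_le_exp θ]
  have hd : 0 ≤ 1 - Real.exp (-θ) := sub_nonneg.2 (Real.exp_le_one_iff.2 (by linarith))
  have hinl : ∀ i, (expect (cond M₁ M₂ β (Sum.inl i) v)
      fun z => expPot θ e (Function.update x (Sum.inl i) z)) = expPot θ e x := fun i => by
    simp only [expPot, minority_update_inl, expect_const]
  have hinr : ∀ i, (expect (cond M₁ M₂ β (Sum.inr i) v)
      fun z => expPot θ e (Function.update x (Sum.inr i) z)) ≤
      expPot θ e x * (1 + p * (Real.exp θ - 1)) - expPot θ e x *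
        (p * (Real.exp θ - 1) + (1 - p) * (1 - Real.exp (-θ))) *
          (if x (Sum.inr i) ≠ e then 1 else 0) := fun i => by
    have h₁ := toReal_units_add (cond M₁ M₂ β (Sum.inr i) v) e
    rw [expect_units _ _ e]
    set q := (cond M₁ M₂ β (Sum.inr i) v (-e)).toReal
    have hq : q ≤ p := hp i
    have h₂ : (cond M₁ M₂ β (Sum.inr i) v e).toReal = 1 - q := by linarith
    have h₃ := minority_update_inr_add e x i e
    have h₄ := minority_update_inr_add e x i (-e)
    rw [if_neg (not_not.2 rfl), add_zero] at h₃
    rw [if_pos (units_neg_ne e)] at h₄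
    rw [h₂]
    split_ifs at h₃ h₄ ⊢ with hi
    · have e₁ : expPot θ e (Function.update x (Sum.inr i) e) =
          expPot θ e x * Real.exp (-θ) := by
        rw [expPot, expPot, ← h₃, ← Real.exp_add]
        push_cast
        ring_nf
      have e₂ : expPot θ e (Function.update x (Sum.inr i) (-e)) = expPot θ e x := by
        rw [expPot, expPot, Nat.add_right_cancel h₄]
      rw [e₁, e₂]
      -- Replacing the true probability `q` by its bound `p` can only raise the estimate, as `exp
      -- (-θ) ≤ 1 ≤ exp θ`.
      have := mul_nonneg (mul_nonneg hV.le (sub_nonneg.2 hq)) hd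
      linarith
    · have e₁ : expPot θ e (Function.update x (Sum.inr i) e) = expPot θ e x := by
        rw [expPot, expPot, ← h₃, add_zero]
      have e₂ : expPot θ e (Function.update x (Sum.inr i) (-e)) =
          expPot θ e x * Real.exp θ := by
        rw [add_zero] at h₄
        rw [expPot, expPot, h₄, ← Real.exp_add]
        push_cast
        ring_nf
      rw [e₁, e₂]
      have := mul_nonneg (mul_nonneg hV.le (sub_nonneg.2 hq)) hu
      linarith
  rw [expect_staleStep, card_var, Fintype.sum_sum_type, Finset.sum_congr rfl fun i _ => hinl i,
    div_le_iff₀ (by positivity)]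
  have hsum := Finset.sum_le_sum fun (i : Fin N) (_ : i ∈ Finset.univ) => hinr i
  simp only [Finset.sum_sub_distrib, ← Finset.mul_sum, Finset.sum_boole, Finset.sum_const,
    Finset.card_univ, Fintype.card_fin, nsmul_eq_mul] at hsum ⊢
  have hm : ((Finset.univ.filter fun i => x (Sum.inr i) ≠ e).card : ℝ) = minority e x := rfl
  rw [hm] at hsum
  refine (add_le_add_right hsum _).trans_eq ?_
  field_simp
  ring

/-- The field towards `e` on any one variable is at least `a` after removal of its own spin, and `1
+ exp a ≥ 2 + a`. -/
theorem cond_inr_neg_le {e : ℤˣ} {v : State N} (i : Fin N) {a : ℝ} (ha₀ : 0 ≤ a)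
    (ha : a ≤ 4 * strength M₂ β v * ((N : ℝ) - 2 * minority e v - 1))
    (hs : 0 ≤ strength M₂ β v) :
    (cond M₁ M₂ β (Sum.inr i) v (-e)).toReal ≤ 1 / (2 + a) := by
  rw [cond_inr]
  refine one_div_le_one_div_of_le (by linarith) ?_
  have h₁ := mul_sumY e v
  have h₂ : (e : ℤ) * v (Sum.inr i) ≤ 1 := by
    generalize v (Sum.inr i) = b
    clear * -
    revert e b
    decide
  have h₃ : ((N : ℝ) - 2 * minority e v - 1) ≤
      -(((-e : ℤˣ) : ℤ) * (sumY v - v (Sum.inr i)) : ℤ) := by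
    have h₄ : (N : ℤ) - 2 * minority e v - 1 ≤ -(((-e : ℤˣ) : ℤ) * (sumY v - v (Sum.inr i))) := by
      rw [Units.val_neg]
      linarith
    exact_mod_cast h₄
  have h₅ := mul_le_mul_of_nonneg_left h₃ (mul_nonneg zero_le_four hs)
  have h₆ := Real.add_one_le_exp (-(4 * strength M₂ β v *
    (((-e : ℤˣ) : ℤ) * (sumY v - v (Sum.inr i)) : ℤ)))
  linarith

end Drift

/-! ### Drift of the exponential potential over one write and over a block. -/

section DriftBounds

variable {N : ℕ}

theorem minority_congr {e : ℤˣ} {v x : State N} (h : v ∘ Sum.inr = x ∘ Sum.inr) :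
    minority e v = minority e x := by
  unfold minority
  congr 1
  ext i
  have := congrFun h i
  simp only [Function.comp_apply] at this
  simp [this]

theorem strength_nonneg {β : ℝ} (hβ : 0 ≤ β) (v : State N) : 0 ≤ strength 1 β v := by
  unfold strength
  split_ifs <;> positivity

variable [NeZero N] (M₁ β : ℝ)

theorem half_mem_of_region {θ : ℝ} {e : ℤˣ} {x : State N} (hlow : (1 - θ) * N ≤ 2 * minority e x)
    (hhigh : 2 * minority e x ≤ N) :
    (1 - θ) / 2 ≤ (minority e x : ℝ) / N ∧ (minority e x : ℝ) / N ≤ 1 / 2 := by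
  have hN : (0 : ℝ) < N := by exact_mod_cast NeZero.pos N
  have h : 2 * (minority e x : ℝ) ≤ N := by exact_mod_cast hhigh
  exact ⟨by rw [le_div_iff₀ hN]; linarith, by rw [div_le_iff₀ hN]; linarith⟩

/-- In this window the minority fraction is within `θ / 2` of one half, so even fair resampling
raises the potential only to second order in `θ`. An unbalanced view gives a first-order decrease.
-/
theorem expect_expPot_le_of_region (hβ : 0 ≤ β) {θ : ℝ} (hθ : 0 ≤ θ) (hθ' : θ ≤ 1) {e : ℤˣ}
    {v x : State N} (hv : v ∘ Sum.inr = x ∘ Sum.inr) (hlow : (1 - θ) * N ≤ 2 * minority e x)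
    (hhigh : 2 * minority e x + 2 ≤ N) :
    expect (bankStep M₁ 1 β v x) (expPot θ e) ≤
      expPot θ e x * (1 + θ ^ 2 / 2 - θ / 6 * unbalanced v) := by
  obtain ⟨h₁, h₂⟩ := half_mem_of_region hlow (by omega)
  have hV := expPot_pos θ e x
  have hu := (abs_le.1 (Real.abs_exp_sub_one_sub_id_le (abs_le.2 ⟨by linarith, hθ'⟩))).2
  have hd := (abs_le.1 (Real.abs_exp_sub_one_sub_id_le (x := -θ)
    (abs_le.2 ⟨by linarith, by linarith⟩))).2
  have hm : 2 * (minority e x : ℝ) + 2 ≤ N := by exact_mod_cast hhigh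
  have hs := strength_nonneg hβ v
  set μ : ℝ := minority e x / N with hμ
  have h₃ := mul_le_mul_of_nonneg_left hu (by linarith : (0 : ℝ) ≤ 1 - μ)
  have h₄ := mul_le_mul_of_nonneg_left hd (by linarith : (0 : ℝ) ≤ μ)
  have h₅ := mul_le_mul_of_nonneg_left h₁ hθ
  have h₆ := mul_le_mul_of_nonneg_left h₂ (sq_nonneg θ)
  by_cases hX : |sumX v| = 1
  · refine (expect_expPot_le M₁ 1 β hθ (p := 1 / 2) fun i => ?_).trans
      (mul_le_mul_of_nonneg_left ?_ hV.le)
    · have := cond_inr_neg_le M₁ 1 β (e := e) i le_rfl (v := v) (by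
        rw [minority_congr hv]
        exact mul_nonneg (by linarith) (by linarith)) hs
      simpa using this
    · rw [unbalanced, if_pos hX, ← hμ]
      linarith
  -- The margin `N - 2 * minority ≥ 2` leaves a sum of at least one after removal of the own spin;
  -- with coupling one the field is at least `4`, and `1 / (2 + 4) = 1 / 6`.
  · refine (expect_expPot_le M₁ 1 β hθ (p := 1 / 6) fun i => ?_).trans
      (mul_le_mul_of_nonneg_left ?_ hV.le)
    · have := cond_inr_neg_le M₁ 1 β (e := e) i zero_le_four (v := v) (by
        rw [minority_congr hv, strength, if_neg hX]
        linarith) hs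
      norm_num at this ⊢
      exact this
    · rw [unbalanced, if_neg hX, ← hμ]
      linarith

theorem expect_blockStep (f : State N → ℝ) (x : State N) :
    expect (blockStep (twoBank N M₁ 1 β) (twoBank_ne_zero N M₁ 1 β) x) f =
      expect (bankStep M₁ 1 β x x) fun x₁ => expect (bankStep M₁ 1 β x₁ x₁) fun x₂ =>
        expect (PMF.uniformOfFintype (Fin N → Bool)) fun U =>
          expect (bankStep M₁ 1 β (mixView U x x₂) x₂) f := by
  simp only [blockStep, expect_bind]

/-- In a window below one half, the potential does not grow on average over a block. -/
theorem expect_blockStep_expPot_le (hN : 3 ≤ N) (hβ : 0 ≤ β) {θ : ℝ} (hθ : 0 ≤ θ)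
    (hθ' : θ ≤ 1 / 10000) {e : ℤˣ} {x : State N} (hlow : (1 - θ) * N + 4 ≤ 2 * minority e x)
    (hhigh : 2 * minority e x + 6 ≤ N) :
    expect (blockStep (twoBank N M₁ 1 β) (twoBank_ne_zero N M₁ 1 β) x) (expPot θ e) ≤
      expPot θ e x := by
  have hV := expPot_pos θ e x
  set w : ℝ := 1 + θ ^ 2 / 2 with hw
  have hw0 : 0 ≤ w := by positivity
  -- The margins `4` and `6` in the hypotheses keep the state in the window of the one-write bound:
  -- two writes change `2 * minority` by at most `4`.
  have plain : ∀ y : State N, (1 - θ) * N ≤ 2 * minority e y → 2 * minority e y + 2 ≤ N →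
      expect (bankStep M₁ 1 β y y) (expPot θ e) ≤ w * expPot θ e y := fun y h₁ h₂ => by
    refine (expect_expPot_le_of_region M₁ β hβ hθ (by linarith) rfl h₁ h₂).trans ?_
    have h₃ := mul_nonneg (mul_nonneg (expPot_pos θ e y).le hθ) (unbalanced_nonneg y)
    rw [hw]
    linarith
  have hexp : Real.exp θ * Real.exp θ ≤ 2 := by
    have hu := (abs_le.1 (Real.abs_exp_sub_one_sub_id_le
      (abs_le.2 ⟨by linarith, by linarith⟩ : |θ| ≤ 1))).2
    have hu' : Real.exp θ ≤ 6 / 5 := by nlinarith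
    nlinarith [Real.exp_pos θ]
  have third : ∀ i z j z', (expect (PMF.uniformOfFintype (Fin N → Bool)) fun U =>
      expect (bankStep M₁ 1 β
        (mixView U x (Function.update (Function.update x i z) j z'))
        (Function.update (Function.update x i z) j z')) (expPot θ e)) ≤
      w * expPot θ e (Function.update (Function.update x i z) j z') -
        θ / 12 * expPot θ e x * viewProb x (Function.update (Function.update x i z) j z') :=
    fun i z j z' => by
      have m₁ := minority_update_le e x i z
      have m₂ := minority_update_le e (Function.update x i z) j z'
      have v₁ := (expPot_update_le hθ e x i z).2
      have v₂ := (expPot_update_le hθ e (Function.update x i z) j z').2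
      set y := Function.update (Function.update x i z) j z' with hy
      have hm : (minority e x : ℝ) ≤ minority e y + 2 := by exact_mod_cast (by omega)
      -- The potential at most halves in two writes, so the gain `θ / 6` at the third write is at
      -- least `θ / 12` in terms of the potential at the start.
      have hVy : expPot θ e x ≤ 2 * expPot θ e y := by
        have := mul_le_mul_of_nonneg_left v₂ (Real.exp_pos θ).le
        have := mul_le_mul_of_nonneg_right hexp (expPot_pos θ e y).le
        linarith
      rw [viewProb, ← expect_const_mul, ← expect_const (PMF.uniformOfFintype (Fin N → Bool))
        (w * expPot θ e y), ← expect_sub]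
      refine expect_mono _ fun U => ?_
      refine (expect_expPot_le_of_region M₁ β hβ hθ (by linarith) (e := e)
        (v := mixView U x y) (x := y) rfl (by linarith) (by omega)).trans ?_
      have := mul_le_mul_of_nonneg_left hVy
        (mul_nonneg (by linarith : 0 ≤ θ / 12) (unbalanced_nonneg (mixView U x y)))
      rw [hw]
      linarith
  have second : ∀ i z, (expect (bankStep M₁ 1 β (Function.update x i z) (Function.update x i z))
      fun x₂ => expect (PMF.uniformOfFintype (Fin N → Bool)) fun U =>
        expect (bankStep M₁ 1 β (mixView U x x₂) x₂) (expPot θ e)) ≤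
      w * w * expPot θ e (Function.update x i z) - θ / 12 * expPot θ e x *
        expect (bankStep M₁ 1 β (Function.update x i z) (Function.update x i z)) (viewProb x) :=
    fun i z => by
      have m₁ := minority_update_le e x i z
      have hm : (minority e x : ℝ) ≤ minority e (Function.update x i z) + 1 := by
        exact_mod_cast m₁.2
      refine (expect_staleStep_mono (g := fun x₂ => w * expPot θ e x₂ -
        θ / 12 * expPot θ e x * viewProb x x₂) fun j z' => third i z j z').trans ?_
      rw [expect_sub _ (fun x₂ => w * expPot θ e x₂)
        (fun x₂ => θ / 12 * expPot θ e x * viewProb x x₂), expect_const_mul, expect_const_mul]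
      have := mul_le_mul_of_nonneg_left
        (plain (Function.update x i z) (by linarith) (by omega)) hw0
      linarith
  rw [expect_blockStep]
  refine (expect_staleStep_mono (g := fun x₁ => w * w * expPot θ e x₁ - θ / 12 * expPot θ e x *
    expect (bankStep M₁ 1 β x₁ x₁) (viewProb x)) second).trans ?_
  rw [expect_sub _ (fun x₁ => w * w * expPot θ e x₁) (fun x₁ => θ / 12 * expPot θ e x *
    expect (bankStep M₁ 1 β x₁ x₁) (viewProb x)), expect_const_mul, expect_const_mul]
  have h₁ := mul_le_mul_of_nonneg_left (plain x (by linarith) (by omega)) (mul_nonneg hw0 hw0)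
  have h₂ := mul_le_mul_of_nonneg_left (le_expect_viewProb M₁ 1 β hN x)
    (mul_nonneg (by linarith : 0 ≤ θ / 12) hV.le)
  have hθ2 : θ ^ 2 ≤ 1 / 10000 * θ := by nlinarith
  have h₃ : w * w * w ≤ 1 + 2 * θ ^ 2 := by
    have h0 : 0 ≤ θ ^ 2 := sq_nonneg θ
    have h1 : θ ^ 2 ≤ 1 / 100 := by linarith
    rw [hw]
    nlinarith [mul_nonneg h0 (sub_nonneg.2 h1), mul_nonneg (mul_nonneg h0 h0) (sub_nonneg.2 h1)]
  -- The second-order growth `2 * θ ^ 2` must not exceed the gain `θ / 4608`; this is where `θ ≤ 1 /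
  -- 10000` is needed.
  have h₄ : w * w * w - θ / 12 * (1 / 384) ≤ 1 := by linarith
  have h₅ := mul_le_mul_of_nonneg_right h₄ hV.le
  linarith

end DriftBounds

/-! ### Metastability of the second bank -/

section Metastable

variable {N : ℕ}

/-- The exponential potential, capped just below one half. -/
noncomputable def cappedPot (θ : ℝ) (e : ℤˣ) (x : State N) : ℝ :=
  min (expPot θ e x) (Real.exp (θ * ((N - 6) / 2)))

theorem cappedPot_pos (θ : ℝ) (e : ℤˣ) (x : State N) : 0 < cappedPot θ e x :=
  lt_min (expPot_pos θ e x) (Real.exp_pos _)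

theorem cappedPot_update_le {θ : ℝ} (hθ : 0 ≤ θ) (e : ℤˣ) (x : State N) (i : Var N) (z : ℤˣ) :
    cappedPot θ e (Function.update x i z) ≤ Real.exp θ * cappedPot θ e x := by
  rw [cappedPot, cappedPot, mul_min_of_nonneg _ _ (Real.exp_pos θ).le]
  exact min_le_min (expPot_update_le hθ e x i z).1
    (le_mul_of_one_le_left (Real.exp_pos _).le (Real.one_le_exp hθ))

variable [NeZero N] (M₁ β : ℝ)

theorem expect_bankStep_cappedPot_le {θ : ℝ} (hθ : 0 ≤ θ) (e : ℤˣ) (v x : State N) :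
    expect (bankStep M₁ 1 β v x) (cappedPot θ e) ≤ Real.exp θ * cappedPot θ e x :=
  (expect_staleStep_mono (g := fun _ => Real.exp θ * cappedPot θ e x)
    fun i z => cappedPot_update_le hθ e x i z).trans_eq (expect_const _ _)

theorem expect_bankStep_expPot_le {θ : ℝ} (hθ : 0 ≤ θ) (e : ℤˣ) (v x : State N) :
    expect (bankStep M₁ 1 β v x) (expPot θ e) ≤ Real.exp θ * expPot θ e x :=
  (expect_staleStep_mono (g := fun _ => Real.exp θ * expPot θ e x)
    fun i z => (expPot_update_le hθ e x i z).1).trans_eq (expect_const _ _)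

/-- At the cap nothing can grow, and in the window the drift is nonpositive. Below the window
`minority < (1 - θ) * N / 2 + 2`, and three writes add at most `3`: this gives the additive error
with its `5`. -/
theorem expect_blockStep_cappedPot_le (hN : 3 ≤ N) (hβ : 0 ≤ β) {θ : ℝ} (hθ : 0 ≤ θ)
    (hθ' : θ ≤ 1 / 10000) (e : ℤˣ) (x : State N) :
    expect (blockStep (twoBank N M₁ 1 β) (twoBank_ne_zero N M₁ 1 β) x) (cappedPot θ e) ≤
      cappedPot θ e x + Real.exp (θ * ((1 - θ) * N / 2 + 5)) := by
  have hB := Real.exp_pos (θ * ((1 - θ) * N / 2 + 5))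
  rcases le_or_gt ((N - 6) / 2 : ℝ) (minority e x) with h | h
  · have h₁ : cappedPot θ e x = Real.exp (θ * ((N - 6) / 2)) :=
      min_eq_right (Real.exp_le_exp.2 (mul_le_mul_of_nonneg_left h hθ))
    rw [h₁]
    exact (expect_le _ fun y => min_le_right _ _).trans (le_add_of_nonneg_right hB.le)
  have h₁ : cappedPot θ e x = expPot θ e x :=
    min_eq_left (Real.exp_le_exp.2 (mul_le_mul_of_nonneg_left h.le hθ))
  refine (expect_mono _ fun y => min_le_left _ _).trans ?_
  rcases le_or_gt ((1 - θ) * N + 4) (2 * minority e x : ℝ) with h' | h'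
  · rw [h₁]
    refine (expect_blockStep_expPot_le M₁ β hN hβ hθ hθ' h' ?_).trans
      (le_add_of_nonneg_right hB.le)
    have : (2 * minority e x + 6 : ℝ) ≤ N := by linarith
    exact_mod_cast this
  · have h₂ : expect (blockStep (twoBank N M₁ 1 β) (twoBank_ne_zero N M₁ 1 β) x) (expPot θ e) ≤
        Real.exp θ * (Real.exp θ * (Real.exp θ * expPot θ e x)) := by
      have one := expect_bankStep_expPot_le (N := N) M₁ β hθ e
      have hpos := (Real.exp_pos θ).le
      rw [expect_blockStep]
      calc _ ≤ expect (bankStep M₁ 1 β x x) fun x₁ => expect (bankStep M₁ 1 β x₁ x₁) fun x₂ =>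
            Real.exp θ * expPot θ e x₂ :=
            expect_mono _ fun x₁ => expect_mono _ fun x₂ => expect_le _ fun U => one _ x₂
        _ ≤ expect (bankStep M₁ 1 β x x) fun x₁ => Real.exp θ * (Real.exp θ * expPot θ e x₁) :=
            expect_mono _ fun x₁ => by
              rw [expect_const_mul]
              exact mul_le_mul_of_nonneg_left (one _ x₁) hpos
        _ ≤ _ := by
            rw [expect_const_mul, expect_const_mul]
            exact mul_le_mul_of_nonneg_left (mul_le_mul_of_nonneg_left (one _ x) hpos) hpos
    refine h₂.trans (le_trans ?_ (le_add_of_nonneg_left (cappedPot_pos θ e x).le))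
    rw [expPot, ← Real.exp_add, ← Real.exp_add, ← Real.exp_add]
    refine Real.exp_le_exp.2 ?_
    have := mul_le_mul_of_nonneg_left h'.le hθ
    linarith

/-- The law of the Hogwild sampler started from the state whose variables all equal `e`. -/
noncomputable abbrev hogFrom (N : ℕ) [NeZero N] (M₁ β : ℝ) (e : ℤˣ) (t : ℕ) : PMF (State N) :=
  hogLaw (twoBank N M₁ 1 β) (twoBank_ne_zero N M₁ 1 β) (tripleDelay N) t (PMF.pure fun _ => e)

theorem expect_hogFrom_three_mul_le (hN : 3 ≤ N) (hβ : 0 ≤ β) {θ : ℝ} (hθ : 0 ≤ θ)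
    (hθ' : θ ≤ 1 / 10000) (e : ℤˣ) (k : ℕ) :
    expect (hogFrom N M₁ β e (3 * k)) (cappedPot θ e) ≤
      1 + k * Real.exp (θ * ((1 - θ) * N / 2 + 5)) := by
  induction k with
  | zero =>
    have h₁ : hogFrom N M₁ β e (3 * 0) = PMF.pure fun _ => e := by
      simp only [hogFrom, hogLaw, mul_zero, Function.iterate_zero, id, PMF.pure_map]
      rfl
    rw [h₁, expect_pure]
    refine (min_le_left _ _).trans ?_
    simp [expPot, minority]
  | succ k ih =>
    rw [hogFrom, mul_add, mul_one, hogLaw_add_three _ _ (by omega), expect_bind]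
    refine (expect_mono _ fun x =>
      expect_blockStep_cappedPot_le M₁ β hN hβ hθ hθ' e x).trans ?_
    rw [expect_add, expect_const]
    push_cast
    linarith

/-- At most two writes follow the last complete block, each costing a factor `exp θ`. -/
theorem expect_hogFrom_le (hN : 3 ≤ N) (hβ : 0 ≤ β) {θ : ℝ} (hθ : 0 ≤ θ)
    (hθ' : θ ≤ 1 / 10000) (e : ℤˣ) (t : ℕ) :
    expect (hogFrom N M₁ β e t) (cappedPot θ e) ≤
      Real.exp (2 * θ) * (1 + t * Real.exp (θ * ((1 - θ) * N / 2 + 5))) := by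
  have step : ∀ s, s % 3 ≠ 2 → expect (hogFrom N M₁ β e (s + 1)) (cappedPot θ e) ≤
      Real.exp θ * expect (hogFrom N M₁ β e s) (cappedPot θ e) := fun s hs => by
    rw [hogFrom, hogLaw_succ _ _ hs, expect_bind, ← expect_const_mul]
    exact expect_mono _ fun x => expect_bankStep_cappedPot_le M₁ β hθ e x x
  set k := t / 3 with hk
  have hB := Real.exp_pos (θ * ((1 - θ) * N / 2 + 5))
  have hkt : (k : ℝ) ≤ t := by exact_mod_cast Nat.div_le_self t 3
  have h₀ : expect (hogFrom N M₁ β e (3 * k)) (cappedPot θ e) ≤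
      1 + t * Real.exp (θ * ((1 - θ) * N / 2 + 5)) :=
    (expect_hogFrom_three_mul_le M₁ β hN hβ hθ hθ' e k).trans (by gcongr)
  have hone := Real.one_le_exp hθ
  have hpos := (Real.exp_pos θ).le
  have h2 : Real.exp (2 * θ) = Real.exp θ * Real.exp θ := by rw [two_mul, Real.exp_add]
  set Q := 1 + t * Real.exp (θ * ((1 - θ) * N / 2 + 5)) with hQ
  have hQ0 : 0 ≤ Q := by positivity
  have h₁ : Real.exp θ * expect (hogFrom N M₁ β e (3 * k)) (cappedPot θ e) ≤ Real.exp θ * Q :=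
    mul_le_mul_of_nonneg_left h₀ hpos
  have hQ1 : Q ≤ Real.exp θ * Q := le_mul_of_one_le_left hQ0 hone
  have hQ2 : Real.exp θ * Q ≤ Real.exp θ * (Real.exp θ * Q) := mul_le_mul_of_nonneg_left hQ1 hpos
  rw [h2, mul_assoc]
  obtain h | h | h : t = 3 * k ∨ t = 3 * k + 1 ∨ t = 3 * k + 1 + 1 := by omega
  · rw [h]
    linarith
  · have h₂ := step (3 * k) (by omega)
    rw [h]
    linarith
  · have h₂ := step (3 * k) (by omega)
    have h₃ := step (3 * k + 1) (by omega)
    have h₄ := mul_le_mul_of_nonneg_left (h₂.trans h₁) hpos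
    rw [h]
    linarith

/-- Up to times exponential in `N`, the second bank keeps the majority it started with. -/
theorem expect_hogFrom_minority_le (hN : 3 ≤ N) (hβ : 0 ≤ β) {θ : ℝ} (hθ : 0 ≤ θ)
    (hθ' : θ ≤ 1 / 10000) (e : ℤˣ) {t : ℕ} (ht : (t : ℝ) ≤ Real.exp (θ ^ 2 / 4 * N))
    {A : Set (State N)} (hA : ∀ x ∈ A, N ≤ 2 * minority e x) :
    expect (hogFrom N M₁ β e t) (A.indicator 1) ≤ 3 * Real.exp (-(θ ^ 2 / 4 * N)) := by
  have hNR : (3 : ℝ) ≤ N := by exact_mod_cast hN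
  -- Markov's inequality: on `A` the potential is at its cap.
  have h₁ : ∀ x, (A.indicator 1 x : ℝ) ≤ Real.exp (-(θ * ((N - 6) / 2))) * cappedPot θ e x := by
    intro x
    by_cases hx : x ∈ A
    · have h₂ : (N : ℝ) ≤ 2 * minority e x := by exact_mod_cast hA x hx
      have h₃ : cappedPot θ e x = Real.exp (θ * ((N - 6) / 2)) :=
        min_eq_right (Real.exp_le_exp.2 (mul_le_mul_of_nonneg_left (by linarith) hθ))
      rw [h₃, ← Real.exp_add, neg_add_cancel, Real.exp_zero, Set.indicator_of_mem hx]
      exact le_rfl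
    · rw [Set.indicator_of_notMem hx]
      exact mul_nonneg (Real.exp_pos _).le (cappedPot_pos θ e x).le
  refine (expect_mono _ h₁).trans ?_
  rw [expect_const_mul]
  refine (mul_le_mul_of_nonneg_left (expect_hogFrom_le M₁ β hN hβ hθ hθ' e t)
    (Real.exp_pos _).le).trans ?_
  have hθ1 : 0 ≤ θ * ((1 - θ) * N / 2 + 5) := by
    refine mul_nonneg hθ (add_nonneg (div_nonneg (mul_nonneg ?_ ?_) ?_) ?_) <;> linarith
  have h₄ : 1 + t * Real.exp (θ * ((1 - θ) * N / 2 + 5)) ≤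
      2 * (Real.exp (θ ^ 2 / 4 * N) * Real.exp (θ * ((1 - θ) * N / 2 + 5))) := by
    have h₅ := Real.one_le_exp hθ1
    have h₆ : 1 ≤ Real.exp (θ ^ 2 / 4 * N) := Real.one_le_exp (by positivity)
    have h₇ := mul_le_mul_of_nonneg_right ht (Real.exp_pos (θ * ((1 - θ) * N / 2 + 5))).le
    have h₈ := one_le_mul_of_one_le_of_one_le h₆ h₅
    linarith
  calc _ ≤ Real.exp (-(θ * ((N - 6) / 2))) * (Real.exp (2 * θ) *
        (2 * (Real.exp (θ ^ 2 / 4 * N) * Real.exp (θ * ((1 - θ) * N / 2 + 5))))) := by gcongr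
    -- The window contributes `-θ ^ 2 / 2 * N` to the exponent, and the time `t` takes back half of
    -- it. The constants `3 θ`, `2 θ` and `5 θ` come from the cap, the incomplete block and the
    -- additive error.
    _ = 2 * Real.exp (10 * θ) * Real.exp (-(θ ^ 2 / 4 * N)) := by
        have e₁ : ∀ a b c d : ℝ, Real.exp a * (Real.exp b * (2 * (Real.exp c * Real.exp d))) =
            2 * Real.exp (a + b + c + d) := fun a b c d => by
          rw [Real.exp_add, Real.exp_add, Real.exp_add]
          ring
        rw [e₁, mul_assoc, ← Real.exp_add]
        congr 2
        ring
    _ ≤ _ := by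
        gcongr
        have hu := (abs_le.1 (Real.abs_exp_sub_one_sub_id_le (x := 10 * θ)
          (abs_le.2 ⟨by linarith, by linarith⟩))).2
        nlinarith

/-- The event of a positive second-bank sum has probability near one from one start and near zero
from the other, so `ν` is off by almost `1 / 2` for at least one of them. In the mixing time `ν` is
the law started from `π`, about which nothing need be known. -/
theorem tvDist_hogFrom_ge (hN : 3 ≤ N) (hβ : 0 ≤ β) {θ : ℝ} (hθ : 0 ≤ θ)
    (hθ' : θ ≤ 1 / 10000) {t : ℕ} (ht : (t : ℝ) ≤ Real.exp (θ ^ 2 / 4 * N)) (ν : PMF (State N)) :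
    ∃ e, 1 / 2 - 3 * Real.exp (-(θ ^ 2 / 4 * N)) ≤ tvDist (hogFrom N M₁ β e t) ν := by
  set A : Set (State N) := {x | 0 < sumY x} with hA
  have h₁ := expect_hogFrom_minority_le M₁ β hN hβ hθ hθ' 1 ht (A := Aᶜ) fun x hx => by
    have := mul_sumY 1 x
    simp only [hA, Set.mem_compl_iff, Set.mem_ofPred_eq] at hx
    rw [Units.val_one] at this
    omega
  have h₂ := expect_hogFrom_minority_le M₁ β hN hβ hθ hθ' (-1) ht (A := A) fun x hx => by
    have := mul_sumY (-1) x
    simp only [hA, Set.mem_ofPred_eq] at hx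
    rw [Units.val_neg, Units.val_one] at this
    omega
  have h₃ : expect (hogFrom N M₁ β 1 t) (Aᶜ.indicator 1) =
      1 - expect (hogFrom N M₁ β 1 t) (A.indicator 1) := by
    rw [← expect_const (hogFrom N M₁ β 1 t) 1, ← expect_sub]
    congr 1
    funext x
    by_cases hx : x ∈ A <;> simp [hx]
  have t₁ := abs_sub_le_tvDist (hogFrom N M₁ β 1 t) ν A
  have t₂ := abs_sub_le_tvDist (hogFrom N M₁ β (-1) t) ν A
  rw [toReal_toOuterMeasure, toReal_toOuterMeasure] at t₁ t₂
  have t₃ := (abs_le.1 t₁).2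
  have t₄ := (abs_le.1 t₂).1
  by_contra! h
  have h₄ := h 1
  have h₅ := h (-1)
  linarith

end Metastable

/-- With the delays of `tripleDelay`, Hogwild Gibbs sampling takes exponentially long to mix. -/
theorem exists_exp_le_hogMixingTime (M₁ : ℕ → ℝ) {β : ℝ} (hβ : 0 ≤ β) :
    ∃ c : ℝ, 0 < c ∧ ∀ ε : ℝ, ε < 1 / 2 → ∃ N₀ : ℕ, ∀ (N : ℕ) [NeZero N], N₀ ≤ N →
      ENNReal.ofReal (Real.exp (c * N)) ≤
        (hogMixingTime N (M₁ N) 1 β (tripleDelay N) ε : ℝ≥0∞) := by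
  set θ : ℝ := 1 / 10000 with hθ
  have hθ0 : 0 < θ := by norm_num [hθ]
  have hc : 0 < θ ^ 2 / 4 := by positivity
  refine ⟨θ ^ 2 / 4, hc, fun ε hε => ?_⟩
  set c := θ ^ 2 / 4 with hcdef
  have hgap : 0 < 1 / 2 - ε := by linarith
  refine ⟨max 3 ⌈3 / (c * (1 / 2 - ε))⌉₊, fun N _ hN => ofReal_le_mixingTime fun t ht => ?_⟩
  have hN3 : 3 ≤ N := (le_max_left _ _).trans hN
  obtain ⟨e, he⟩ := tvDist_hogFrom_ge (M₁ N) β hN3 hβ hθ0.le le_rfl ht.le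
    (hogLaw (twoBank N (M₁ N) 1 β) (twoBank_ne_zero N (M₁ N) 1 β) (tripleDelay N) t
      (twoBank N (M₁ N) 1 β))
  refine ⟨PMF.pure fun _ => e, lt_of_lt_of_le ?_ he⟩
  have hNε : 3 / (c * (1 / 2 - ε)) ≤ N :=
    (Nat.le_ceil _).trans (by exact_mod_cast (le_max_right _ _).trans hN)
  rw [div_le_iff₀ (by positivity)] at hNε
  have h₁ : c * N < Real.exp (c * N) := by linarith [Real.add_one_le_exp (c * N)]
  -- The bound `exp u > u` suffices to make the error `3 * exp (-(c * N))` smaller than the gap `1 /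
  -- 2 - ε`.
  have h₂ : 3 < Real.exp (c * N) * (1 / 2 - ε) := by
    have := mul_lt_mul_of_pos_right h₁ hgap
    linarith
  have h₃ : 3 * Real.exp (-(c * N)) < 1 / 2 - ε := by
    rw [Real.exp_neg, ← div_eq_mul_inv, div_lt_iff₀ (Real.exp_pos _)]
    linarith
  linarith

end GibbsMixing

theorem mainTheorem7 :
    ∃ M₁ M₂ β : ℕ → ℝ,
      (∀ N, 0 < M₁ N ∧ 0 < M₂ N ∧ 0 < β N) ∧
      (∀ ε : ℝ, 0 < ε → ∃ C : ℝ, 0 < C ∧ ∃ N₀ : ℕ, ∀ (N : ℕ) [NeZero N], Odd N → N₀ ≤ N →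
        (GibbsMixing.seqMixingTime N (M₁ N) (M₂ N) (β N) ε : ENNReal) ≤
          ENNReal.ofReal (C * (N * Real.log N))) ∧
      (∃ (τ τ' : NNReal) (D : ∀ N : ℕ, GibbsMixing.DelayModel (GibbsMixing.Var N) ℤˣ),
        (∀ N, (D N).ExpectedDelayLE τ ∧ (D N).ExpDelayLE τ' ∧ (D N).Oblivious) ∧
        ∃ c : ℝ, 0 < c ∧ ∀ ε : ℝ, 0 < ε → ε < 1 / 2 →
          ∃ N₀ : ℕ, ∀ (N : ℕ) [NeZero N], Odd N → N₀ ≤ N →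
            ENNReal.ofReal (Real.exp (c * N)) ≤
              (GibbsMixing.hogMixingTime N (M₁ N) (M₂ N) (β N) (D N) ε : ENNReal)) := by
  -- `M₁` only has to outweigh `M₂ * N ^ 2 / 2` with room to spare, and `β = 1 / 32` is the largest
  -- value allowed by the contraction bound. All delays are at most two, hence `2` and `16`.
  refine ⟨fun N => (N : ℝ) ^ 2 + 1, fun _ => 1, fun _ => 1 / 32,
    fun N => ⟨by positivity, by norm_num, by norm_num⟩,
    fun ε hε => GibbsMixing.seqMixingTime_le hε, 2, 16, GibbsMixing.tripleDelay,
    fun N => ⟨GibbsMixing.tripleDelay_expectedDelayLE N, GibbsMixing.tripleDelay_expDelayLE N,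
      GibbsMixing.tripleDelay_oblivious N⟩, ?_⟩
  obtain ⟨c, hc, h⟩ := GibbsMixing.exists_exp_le_hogMixingTime (fun N => (N : ℝ) ^ 2 + 1)
    (β := 1 / 32) (by norm_num)
  refine ⟨c, hc, fun ε _ hε => ?_⟩
  obtain ⟨N₀, hN₀⟩ := h ε hε
  exact ⟨N₀, fun N _ _ hN => hN₀ N hN⟩
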